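/- **Notation.** For $\mu>0$ put $\delta_\mu(t)=t^{\mu-1}/\Gamma(\mu)$, let ${}_0D_t^{-\mu}y=\delta_\mu*y$ be the Riemann–Liouville fractional integral (the identity for $\mu=0$), and with $n=\lceil\mu\rceil$ let ${}^C_0D_t^{\mu}y={}_0D_t^{-(n-\mu)}y^{(n)}$ and ${}_0D_t^{\mu}y=\frac{d^n}{dt^n}\,{}_0D_t^{-(n-\mu)}y$ be the Caputo and the Riemann–Liouville derivative. For $0<\nu\le\frac12$ and $t>0$ let $R_{\mu,\nu}(a,t)=\mathcal L^{-1}\{s^{-\mu}e^{-as^\nu};t\}$ for $a>0$ and $R_{\mu,\nu}(0,t)=R_{\mu,\nu}(0+,t)=\delta_\mu(t)$, and let $W(z;\alpha,\beta)=\sum_{j\ge0}\frac{z^j}{j!\,\Gamma(\alpha j+\beta)}$ be the Wright function. For $r>0$ and $u_0\in\mathbb R$ consider the moving boundary problem for $u(x,t)$ and $\eta(t)>0$ $$ \begin{cases} D^{2\nu}u=\partial_x^2u, & 0<x<\eta(t),\ t>0,\\ \Phi u(x,0+)=u_0, & x>0,\\ u(0,t)=1,\quad u(\eta(t),t)=0,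 & t>0,\\ D^{2\nu}\eta(t)=-\frac1r\,\partial_xu(\eta(t),t), & t>0, \end{cases} $$ where either $D^{2\nu}={}^C_0D_t^{2\nu}$ and $\Phi u=u$ (Caputo case), or $D^{2\nu}={}_0D_t^{2\nu}$ and $\Phi u={}_0D_t^{-(1-2\nu)}u$ (Riemann–Liouville case). **(1) Caputo case.** Let $0<\nu\le\frac12$ and $r>0$. The transcendental equation $$\frac{2\alpha r\,\Gamma(1+\nu)}{\Gamma(1-\nu)}\,[1-W(-2\alpha;-\nu,1)]=W(-2\alpha;-\nu,1-\nu)\tag{$*$}$$ has a solution $\alpha>0$. For every $\alpha>0$ one has $W(-2\alpha;-\nu,1)\ne1$, and for every $u_0\in\mathbb R$ the pair $$u(x,t)=\frac{R_{1,\nu}(x,t)-W(-2\alpha;-\nu,1)}{1-W(-2\alpha;-\nu,1)},\qquad \eta(t)=2\alpha t^\nu$$ solves the Caputo problem if and only if $\alpha$ satisfies $(*)$ and $u_0=-\dfrac{W(-2\alpha;-\nu,1)}{1-W(-2\alpha;-\nu,1)}$. **(2) Riemann–Liouville case.** Let $0<\nu<\frac12$ and $u_0\in\mathbb R$. Consider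 the functions $$u(x,t)=\int_{-\infty}^{\infty}\tfrac12R_{\nu,\nu}(|x-\xi|,t)\,u_0\chi_{\mathbb R\setminus\{0\}}(\xi)\,d\xi+\int_0^t\tfrac12R_{2\nu,\nu}(x,t-\tau)\,\varphi^-(\tau)\,d\tau,\qquad x\ge0,\ t>0,$$ with $\varphi^-=\varphi+c\,\delta$, where $\varphi$ is integrable on $(0,t)$ for each $t>0$, $c\in\mathbb R$, and $\delta$ is the Dirac delta at $0$. The choice $\varphi=2\delta_{1-2\nu}$, $c=-2u_0$ is admissible and gives $u(x,t)=u_0\delta_{2\nu}(t)+R_{1,\nu}(x,t)-u_0R_{2\nu,\nu}(x,t)$, which satisfies $u(0,t)=1$ for all $t>0$. But for no such $\varphi$, $c$ and no $\alpha>0$ do both boundary conditions $u(0,t)=1$ and $u(2\alpha t^\nu,t)=0$ hold for all $t>0$; in particular, for no $r>0$ does such a $u$ together with $\eta(t)=2\alpha t^\nu$ solve the Riemann–Liouville problem. **(3) Classical case.** For $\nu=\frac12$ and $\alpha>0$ the pair in (1) is the Neumann solution $$u(x,t)=1-\frac{\operatorname{erf}\bigl(\frac{x}{2\sqrt t}\bigr)}{\operatorname{erf}(\alpha)}\quad(x\ge0,\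 t>0),\qquad \eta(t)=2\alpha\sqrt t\quad(t\ge0),$$ and for every $r>0$ equation $(*)$ is equivalent to $r\sqrt\pi\,\alpha\operatorname{erf}(\alpha)\,e^{\alpha^2}=1$. -/

import Mathlib

open Filter Topology

noncomputable section

/-- The function `δ_μ(t) = t ^ (μ - 1) / Γ(μ)` for `μ > 0`. -/
def fracDelta (μ t : ℝ) : ℝ := t ^ (μ - 1) / Real.Gamma μ

/-- The Riemann-Liouville fractional integral of order `μ ≥ 0` with base point `0`;
the integral of order `0` is the identity. -/
def rlIntegral (μ : ℝ) (y : ℝ → ℝ) (t : ℝ) : ℝ :=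
  if μ = 0 then y t
  else 1 / Real.Gamma μ * ∫ τ in (0 : ℝ)..t, (t - τ) ^ (μ - 1) * y τ

/-- The integral defining `rlIntegral μ y t` converges absolutely. -/
def RLIntegrable (μ : ℝ) (y : ℝ → ℝ) (t : ℝ) : Prop :=
  μ = 0 ∨ IntervalIntegrable (fun τ => (t - τ) ^ (μ - 1) * y τ) MeasureTheory.volume 0 t

/-- `y` has at `t > 0` the Caputo fractional derivative `d` of order `μ`: with `n = ⌈μ⌉`, the
function `y` is `C^n` on `(0, ∞)`, and the fractional integral of order `n - μ` of its `n`-th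
derivative converges at `t` and equals `d`. -/
def HasCaputoDeriv (μ : ℝ) (y : ℝ → ℝ) (t d : ℝ) : Prop :=
  ContDiffOn ℝ (⌈μ⌉₊ : ℕ) y (Set.Ioi 0) ∧
  RLIntegrable ((⌈μ⌉₊ : ℝ) - μ) (iteratedDeriv ⌈μ⌉₊ y) t ∧
  rlIntegral ((⌈μ⌉₊ : ℝ) - μ) (iteratedDeriv ⌈μ⌉₊ y) t = d

/-- `y` has at `t > 0` the Riemann-Liouville fractional derivative `d` of order `μ`: with
`n = ⌈μ⌉`, the fractional integral of order `n - μ` of `y` converges near `t`, is `C^n` near `t`,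
and its `n`-th derivative at `t` is `d`. -/
def HasRLDeriv (μ : ℝ) (y : ℝ → ℝ) (t d : ℝ) : Prop :=
  (∀ᶠ s in 𝓝 t, RLIntegrable ((⌈μ⌉₊ : ℝ) - μ) y s) ∧
  ContDiffAt ℝ (⌈μ⌉₊ : ℕ) (rlIntegral ((⌈μ⌉₊ : ℝ) - μ) y) t ∧
  iteratedDeriv ⌈μ⌉₊ (rlIntegral ((⌈μ⌉₊ : ℝ) - μ) y) t = d

/-- The inverse Laplace transform, as the Bromwich integral
`(1 / 2πi) ∫ e ^ (s t) F(s) ds` along the line `Re s = 1` (for `F` holomorphic in the right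
half-plane and decaying along vertical lines, the abscissa does not matter); `F` is assumed
to be real on the real axis, so that the integral is real. -/
def inverseLaplace (F : ℂ → ℂ) (t : ℝ) : ℝ :=
  (1 / (2 * (Real.pi : ℂ)) *
    ∫ y : ℝ, Complex.exp ((1 + y * Complex.I) * t) * F (1 + y * Complex.I)).re

/-- The auxiliary function `R_{μ,ν}(a,t)`, the inverse Laplace transform of
`s ^ (-μ) * exp (-a s ^ ν)`, for `a > 0`. For `a = 0`, where (for `μ > 0`) the transform
`s ^ (-μ)` has the inverse `δ_μ(t)`, the value is `δ_μ(t)`. -/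
def auxR (μ ν a t : ℝ) : ℝ :=
  if a = 0 then fracDelta μ t
  else inverseLaplace (fun s => s ^ (-(μ : ℂ)) * Complex.exp (-(a : ℂ) * s ^ (ν : ℂ))) t

/-- The Wright function `W(z; α, β) = ∑ z ^ j / (j! Γ(α j + β))` for real arguments. At the poles
of `Γ` the coefficient is `0`, in agreement with `Real.Gamma (-n) = 0` and `x / 0 = 0`. -/
def wrightW (z α β : ℝ) : ℝ :=
  ∑' j : ℕ, z ^ j / ((j.factorial : ℝ) * Real.Gamma (α * j + β))

/-- The error function. -/
def errorFun (x : ℝ) : ℝ := 2 / Real.sqrt Real.pi * ∫ s in (0 : ℝ)..x, Real.exp (-s ^ 2)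

/-- The pair `(u, η)` solves the Stefan problem
`D u = u_xx` for `0 < x < η(t)`, `t > 0`;
`Φ u(x, 0+) = u₀` for `x > 0`;
`u(0,t) = 1`, `u(η(t),t) = 0` for `t > 0`;
`D η(t) = -(1/r) u_x(η(t),t)` for `t > 0`.
Here `HasD y t d` means that `D y` exists at `t` and equals `d`, where `D` is a fractional
derivative in time, and `Φ` is the corresponding operator in the initial condition. The boundary
value at `x = 0` is attained continuously, and `u_x(η(t),t)` is the derivative from the left (so
that the boundary value at `x = η(t)` is attained continuously, too). -/
structure IsStefanSolution (HasD : (ℝ → ℝ) → ℝ → ℝ → Prop) (Φ : (ℝ → ℝ) → ℝ → ℝ)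
    (r u₀ : ℝ) (u : ℝ → ℝ → ℝ) (η : ℝ → ℝ) : Prop where
  boundary_pos : ∀ t > 0, 0 < η t
  pde : ∀ t > 0, ∀ x, 0 < x → x < η t →
    ContDiffAt ℝ 2 (fun ξ => u ξ t) x ∧
      HasD (fun τ => u x τ) t (iteratedDeriv 2 (fun ξ => u ξ t) x)
  initial : ∀ x > 0, Tendsto (fun t => Φ (fun τ => u x τ) t) (𝓝[>] 0) (𝓝 u₀)
  left_value : ∀ t > 0, u 0 t = 1
  left_continuous : ∀ t > 0, ContinuousWithinAt (fun x => u x t) (Set.Ici 0) 0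
  right_value : ∀ t > 0, u (η t) t = 0
  stefan : ∀ t > 0, ∃ q, HasDerivWithinAt (fun x => u x t) q (Set.Iic (η t)) (η t) ∧
    HasD η t (-(1 / r) * q)

/-- Solutions of the Stefan problem with the Caputo derivative of order `2ν`; the initial
condition is `u(x, 0+) = u₀`. -/
def IsCaputoStefanSolution (ν r u₀ : ℝ) (u : ℝ → ℝ → ℝ) (η : ℝ → ℝ) : Prop :=
  IsStefanSolution (HasCaputoDeriv (2 * ν)) (fun y => y) r u₀ u η

/-- Solutions of the Stefan problem with the Riemann-Liouville derivative of order `2ν`; the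
initial condition prescribes the fractional integral of order `1 - 2ν` of `u(x, ·)` at `0+`. -/
def IsRLStefanSolution (ν r u₀ : ℝ) (u : ℝ → ℝ → ℝ) (η : ℝ → ℝ) : Prop :=
  IsStefanSolution (HasRLDeriv (2 * ν)) (rlIntegral (1 - 2 * ν)) r u₀ u η

/-- The similarity solution of the Caputo problem. -/
def similarityU (ν α x t : ℝ) : ℝ :=
  (auxR 1 ν x t - wrightW (-2 * α) (-ν) 1) / (1 - wrightW (-2 * α) (-ν) 1)

/-- The similarity ansatz for the moving boundary. -/
def similarityEta (ν α t : ℝ) : ℝ := 2 * α * t ^ ν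

/-- The transcendental equation for `α`. -/
def TranscendentalEq (ν r α : ℝ) : Prop :=
  2 * α * r * Real.Gamma (1 + ν) / Real.Gamma (1 - ν) * (1 - wrightW (-2 * α) (-ν) 1)
    = wrightW (-2 * α) (-ν) (1 - ν)

/-- The embedding representation of solutions of the Riemann-Liouville time-fractional diffusion
equation on `x ≥ 0` with initial datum `u₀` on `x ≠ 0` and with the source
`φ⁻(t) = φ(t) + c δ(t)` (`δ` the Dirac delta at `0`) on `x ≤ 0`, and no other source:
`u(x,t) = ∫ ½ R_{ν,ν}(|x - ξ|,t) f(ξ) dξ + ∫_0^t ½ R_{2ν,ν}(x,t - τ) φ⁻(τ) dτ`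
with `f = u₀` on `ℝ \ {0}` and `f(0) = 0`. -/
def rlEmbedding (ν u₀ : ℝ) (φ : ℝ → ℝ) (c x t : ℝ) : ℝ :=
  (∫ ξ : ℝ, 1 / 2 * auxR ν ν |x - ξ| t * (if ξ = 0 then 0 else u₀)) +
  ((∫ τ in (0 : ℝ)..t, 1 / 2 * auxR (2 * ν) ν x (t - τ) * φ τ) +
    1 / 2 * c * auxR (2 * ν) ν x t)

end

/-! Everything reduces to contour integrals of the kernel e^{st} s^{-μ} e^{z s^ν}. With z = -a, a >
0 and ν ≤ 1/2 the factor e^{-a s^ν} decays on the Bromwich line, and the line may be bent into a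
Hankel-type contour on which e^{st} decays as well. There z is an arbitrary real number, the
exponential e^{z s^ν} can be expanded term by term, and Hankel's formula for 1/Γ yields R_{μ,ν}(a,t)
= t^{μ-1} W(-a t^{-ν}; -ν, μ) (`auxR_eq_rpow_mul_wrightW`).

The calculus of R is read off from the kernel: ∂_x R_μ = -R_{μ-ν}, ∂_t R_μ = R_{μ-1}, and δ_β * R_μ
= R_{μ+β}. Hence the Caputo derivative of order 2ν and the second space derivative both send R_1 to
R_{1-2ν}. On x = 2αt^ν the function R_1 is the constant W(-2α; -ν, 1), while the flux and the Caputo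
derivative of t^ν are both multiples of t^{-ν}. Equality of the two coefficients is the
transcendental equation, which is solvable by the intermediate value theorem.

The crucial inequality is 0 < W(-x; -ν, 1) < 1 for x > 0 (`wrightW_neg_mem_Ioo`). On the curve where
s - x s^ν is real, with φ = arg s as parameter, Im(ds/s) = dφ, so that W = (1/π) ∫_0^π e^{E(φ)} dφ
with E < 0. The upper bound makes the denominator 1 - W nonzero; the lower bound decides the
Riemann–Liouville case.

In that case the condition u(0,t) = 1 is an Abel equation for φ with an unknown point mass, and its
solution is unique (`abel_uniqueness`). So u is the explicit function, and on x = 2αt^ν it equals W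
+ K t^{2ν-1} with a constant K. This cannot vanish for all t, because W > 0 and 2ν - 1 < 0.

For ν = 1/2 integration by parts gives a first-order differential equation for W(z; -1/2, 1/2),
which makes it a Gaussian; its integral is the error function. -/

open MeasureTheory Set

/-! ### Contour deformation by means of primitives -/

/-- The open upper half-plane together with the positive real axis. -/
def upperSlit : Set ℂ := {s | 0 < s.im ∨ (s.im = 0 ∧ 0 < s.re)}

lemma upperSlit_subset_slitPlane : upperSlit ⊆ Complex.slitPlane := by
  rintro s (h | h)
  · exact Or.inr h.ne'
  · exact Or.inl h.2

/-- The slit plane is not convex, but this half of it is, so holomorphic functions have primitives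
here; conjugation supplies the other half. The positive axis is included because all contours start
on it. -/
lemma convex_upperSlit : Convex ℝ upperSlit := by
  intro x hx y hy a b ha hb hab
  have him : (a • x + b • y).im = a * x.im + b * y.im := by simp
  have hre : (a • x + b • y).re = a * x.re + b * y.re := by simp
  simp only [upperSlit, mem_ofPred_eq, him, hre] at *
  have hx0 : 0 ≤ x.im := by rcases hx with h | h <;> linarith [h]
  have hy0 : 0 ≤ y.im := by rcases hy with h | h <;> linarith [h]
  rcases ha.eq_or_lt with rfl | ha'
  · simp only [zero_add] at hab; subst hab; simpa using hy
  rcases hb.eq_or_lt with rfl | hb'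
  · simp only [add_zero] at hab; subst hab; simpa using hx
  rcases hx with h | h
  · left; have := mul_pos ha' h; have := mul_nonneg hb hy0; linarith
  · rcases hy with h' | h'
    · left; have := mul_pos hb' h'; have := mul_nonneg ha hx0; linarith
    · right
      refine ⟨by rw [h.1, h'.1]; ring, ?_⟩
      have := mul_pos ha' h.2; have := mul_pos hb' h'.2; linarith

/-- A holomorphic function on the slit plane has a primitive on `upperSlit`. -/
lemma exists_primitive_upperSlit {f : ℂ → ℂ} (hf : DifferentiableOn ℂ f Complex.slitPlane) :
    ∃ F : ℂ → ℂ, ∀ s ∈ upperSlit, HasDerivWithinAt F (f s) upperSlit s :=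
  convex_upperSlit.exists_forall_hasDerivWithinAt (hf.mono upperSlit_subset_slitPlane)

lemma hasDerivWithinAt_comp_curve {f F : ℂ → ℂ}
    (hF : ∀ s ∈ upperSlit, HasDerivWithinAt F (f s) upperSlit s) {γ : ℝ → ℂ} {γ' : ℂ} {x : ℝ}
    {S : Set ℝ} (hγ : HasDerivWithinAt γ γ' S x) (hmem : MapsTo γ S upperSlit) (hx : x ∈ S) :
    HasDerivWithinAt (fun y => F (γ y)) (γ' * f (γ x)) S x := by
  have := (hF (γ x) (hmem hx)).scomp x hγ hmem
  simpa [Function.comp_def] using this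

/-- The integral along a ray from `1` in terms of a primitive. -/
lemma tendsto_primitive_ray {f F : ℂ → ℂ}
    (hF : ∀ s ∈ upperSlit, HasDerivWithinAt F (f s) upperSlit s) {d : ℂ}
    (hd : ∀ ρ : ℝ, 0 ≤ ρ → 1 + ρ * d ∈ upperSlit)
    (hint : IntegrableOn (fun ρ : ℝ => d * f (1 + ρ * d)) (Ioi 0)) :
    Tendsto (fun R : ℝ => F (1 + R * d)) atTop
      (𝓝 (F 1 + ∫ ρ : ℝ in Ioi 0, d * f (1 + ρ * d))) := by
  have hγ : ∀ x : ℝ, HasDerivAt (fun ρ : ℝ => 1 + (ρ : ℂ) * d) d x := fun x => by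
    simpa using ((Complex.ofRealCLM.hasDerivAt (x := x)).mul_const d).const_add (1 : ℂ)
  have hD : ∀ x ∈ Ici (0 : ℝ), HasDerivWithinAt (fun ρ : ℝ => F (1 + ρ * d))
      (d * f (1 + x * d)) (Ici 0) x := fun x hx =>
    hasDerivWithinAt_comp_curve hF (hγ x).hasDerivWithinAt (fun y hy => hd y hy) hx
  have hcont : ContinuousOn (fun ρ : ℝ => F (1 + ρ * d)) (Ici 0) :=
    fun x hx => (hD x hx).continuousWithinAt
  have hlim := intervalIntegral_tendsto_integral_Ioi 0 hint tendsto_id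
  have := hlim.const_add (F 1)
  refine this.congr' ?_
  filter_upwards [eventually_ge_atTop 0] with R hR
  have : ∫ ρ in (0 : ℝ)..R, d * f (1 + ρ * d) = F (1 + R * d) - F (1 + (0 : ℝ) * d) := by
    refine intervalIntegral.integral_eq_sub_of_hasDeriv_right_of_le hR
      (hcont.mono Icc_subset_Ici_self) (fun x hx => ?_) ?_
    · exact (hD x hx.1.le).mono (fun y hy => hx.1.le.trans (le_of_lt hy))
    · rw [intervalIntegrable_iff_integrableOn_Ioc_of_le hR]
      exact hint.mono_set Ioc_subset_Ioi_self
  simp [this]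

/-- Rotation of a ray of integration. -/
lemma integral_ray_eq_of_segment_bound {f : ℂ → ℂ} (hf : DifferentiableOn ℂ f Complex.slitPlane)
    {d₁ d₂ : ℂ}
    (hd₁ : ∀ ρ : ℝ, 0 ≤ ρ → 1 + ρ * d₁ ∈ upperSlit)
    (hd₂ : ∀ ρ : ℝ, 0 ≤ ρ → 1 + ρ * d₂ ∈ upperSlit)
    (h₁ : IntegrableOn (fun ρ : ℝ => d₁ * f (1 + ρ * d₁)) (Ioi 0))
    (h₂ : IntegrableOn (fun ρ : ℝ => d₂ * f (1 + ρ * d₂)) (Ioi 0)) {C : ℝ}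
    (hseg : ∀ R : ℝ, 1 ≤ R → ∀ s ∈ segment ℝ (1 + R * d₁) (1 + R * d₂), ‖f s‖ ≤ C / R ^ 2) :
    ∫ ρ : ℝ in Ioi 0, d₁ * f (1 + ρ * d₁) = ∫ ρ : ℝ in Ioi 0, d₂ * f (1 + ρ * d₂) := by
  obtain ⟨F, hF⟩ := exists_primitive_upperSlit hf
  have l₁ := tendsto_primitive_ray hF hd₁ h₁
  have l₂ := tendsto_primitive_ray hF hd₂ h₂
  -- The endpoints of the two rays are at distance R ‖d₂ - d₁‖ and the derivative of `F` is at most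
  -- C / R² between them, so the difference is O(1/R).
  have hz : Tendsto (fun R : ℝ => F (1 + R * d₂) - F (1 + R * d₁)) atTop (𝓝 0) := by
    have hb : Tendsto (fun R : ℝ => C * ‖d₂ - d₁‖ * R⁻¹) atTop (𝓝 0) := by
      simpa using tendsto_inv_atTop_zero.const_mul (C * ‖d₂ - d₁‖)
    refine squeeze_zero_norm' ?_ hb
    filter_upwards [eventually_ge_atTop 1] with R hR
    have hR0 : 0 ≤ R := by linarith
    have hsub : segment ℝ (1 + R * d₁) (1 + R * d₂) ⊆ upperSlit :=
      convex_upperSlit.segment_subset (hd₁ R hR0) (hd₂ R hR0)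
    have := (convex_segment (1 + R * d₁) (1 + R * d₂)).norm_image_sub_le_of_norm_hasDerivWithin_le
      (f := F) (f' := f) (C := C / R ^ 2)
      (fun s hs => (hF s (hsub hs)).mono hsub)
      (hseg R hR) (left_mem_segment ℝ _ _) (right_mem_segment ℝ _ _)
    refine this.trans (le_of_eq ?_)
    have : (1 + R * d₂) - (1 + R * d₁) = R * (d₂ - d₁) := by ring
    rw [this, norm_mul, Complex.norm_real, Real.norm_of_nonneg hR0]
    field_simp
  have := tendsto_nhds_unique hz (l₂.sub l₁)
  have h3 : (F 1 + ∫ ρ : ℝ in Ioi 0, d₂ * f (1 + ρ * d₂)) -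
    (F 1 + ∫ ρ : ℝ in Ioi 0, d₁ * f (1 + ρ * d₁)) = 0 := this.symm
  linear_combination -h3

/-! ### The kernel and its bounds -/

/-- The kernel `exp (s t) s ^ (-μ) exp (z s ^ ν)`. -/
noncomputable def wrightKernel (μ ν z t : ℝ) (s : ℂ) : ℂ :=
  Complex.exp (s * t) * s ^ (-(μ : ℂ)) * Complex.exp (z * s ^ (ν : ℂ))

lemma norm_wrightKernel (μ ν z t : ℝ) (s : ℂ) :
    ‖wrightKernel μ ν z t s‖ =
      Real.exp (s.re * t) * ‖s‖ ^ (-μ) *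
        Real.exp (z * (‖s‖ ^ ν * Real.cos (Complex.arg s * ν))) := by
  have h : (-(μ : ℂ)) = ((-μ : ℝ) : ℂ) := by push_cast; rfl
  rw [wrightKernel, norm_mul, norm_mul, Complex.norm_exp, Complex.norm_exp, h,
    Complex.norm_cpow_real, Complex.re_mul_ofReal, Complex.re_ofReal_mul, Complex.cpow_ofReal_re]

/-- The derivative is written through kernels of shifted order, so that integration along a contour
becomes a recurrence in μ. -/
lemma hasDerivAt_wrightKernel {μ ν z t : ℝ} {s : ℂ} (hs : s ∈ Complex.slitPlane) :
    HasDerivAt (wrightKernel μ ν z t)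
      (t * wrightKernel μ ν z t s - μ * wrightKernel (μ + 1) ν z t s
        + z * ν * wrightKernel (μ + 1 - ν) ν z t s) s := by
  have hs0 : s ≠ 0 := Complex.slitPlane_ne_zero hs
  have h1 : HasDerivAt (fun s : ℂ => Complex.exp (s * t)) (Complex.exp (s * t) * t) s := by
    simpa using ((hasDerivAt_id s).mul_const (t : ℂ)).cexp
  have h2 : HasDerivAt (fun s : ℂ => s ^ (-(μ : ℂ))) (-(μ : ℂ) * s ^ (-(μ : ℂ) - 1) * 1) s :=
    (hasDerivAt_id s).cpow_const hs
  have h3 : HasDerivAt (fun s : ℂ => Complex.exp (z * s ^ (ν : ℂ)))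
      (Complex.exp (z * s ^ (ν : ℂ)) * (z * ((ν : ℂ) * s ^ ((ν : ℂ) - 1) * 1))) s :=
    (((hasDerivAt_id s).cpow_const hs).const_mul (z : ℂ)).cexp
  have h := (h1.mul h2).mul h3
  refine h.congr_deriv ?_
  have e1 : s ^ (-((μ + 1 : ℝ) : ℂ)) = s ^ (-(μ : ℂ) - 1) := by
    congr 1; push_cast; ring
  have e2 : s ^ (-((μ + 1 - ν : ℝ) : ℂ)) = s ^ (-(μ : ℂ)) * s ^ ((ν : ℂ) - 1) := by
    rw [← Complex.cpow_add _ _ hs0]; congr 1; push_cast; ring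
  simp only [wrightKernel, e1, e2, Pi.mul_apply]
  ring

lemma differentiableOn_wrightKernel (μ ν z t : ℝ) :
    DifferentiableOn ℂ (wrightKernel μ ν z t) Complex.slitPlane :=
  fun _ hs => (hasDerivAt_wrightKernel hs).differentiableAt.differentiableWithinAt

lemma continuousOn_wrightKernel (μ ν z t : ℝ) :
    ContinuousOn (wrightKernel μ ν z t) Complex.slitPlane :=
  (differentiableOn_wrightKernel μ ν z t).continuousOn

lemma wrightKernel_conj (μ ν z t : ℝ) {s : ℂ} (hs : s ∈ Complex.slitPlane) :
    wrightKernel μ ν z t (starRingEnd ℂ s) = starRingEnd ℂ (wrightKernel μ ν z t s) := by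
  have ha : s.arg ≠ Real.pi := Complex.slitPlane_arg_ne_pi hs
  have h : ∀ w : ℝ, (starRingEnd ℂ s) ^ (w : ℂ) = starRingEnd ℂ (s ^ (w : ℂ)) := fun w => by
    rw [Complex.conj_cpow _ _ ha, Complex.conj_ofReal]
  have h' : (-(μ : ℂ)) = ((-μ : ℝ) : ℂ) := by push_cast; rfl
  simp only [wrightKernel, map_mul, h', h, ← Complex.exp_conj, Complex.conj_ofReal]

lemma wrightKernel_im_of_pos (μ ν z t : ℝ) {x : ℝ} (hx : 0 < x) :
    (wrightKernel μ ν z t x).im = 0 := by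
  have := wrightKernel_conj μ ν z t (s := (x : ℂ)) (Or.inl (by simpa using hx))
  rw [Complex.conj_ofReal] at this
  exact Complex.conj_eq_iff_im.mp this.symm

lemma cos_three_pi_div_eight_pos : 0 < Real.cos (3 * Real.pi / 8) :=
  Real.cos_pos_of_mem_Ioo ⟨by linarith [Real.pi_pos], by linarith [Real.pi_pos]⟩

/-- The conditions describe the sector 0 ≤ arg s < 3π/4, wide enough for the Hankel ray. Since ν ≤
1/2, multiplication by ν takes the argument into [0, 3π/8], where the cosine stays away from zero.
-/
lemma cos_arg_mul_ge {ν : ℝ} (hν : 0 < ν) (hν' : ν ≤ 1 / 2) {s : ℂ} (h0 : 0 ≤ s.im)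
    (h1 : 0 < s.re + s.im) : Real.cos (3 * Real.pi / 8) ≤ Real.cos (Complex.arg s * ν) := by
  have ha0 : 0 ≤ s.arg := Complex.arg_nonneg_iff.mpr h0
  have hs0 : s ≠ 0 := by rintro rfl; simp at h1
  have ha : s.arg ≤ 3 * Real.pi / 4 := by
    by_contra hc
    push Not at hc
    have hp := Complex.arg_le_pi s
    -- ‖s‖ cos(arg s - π/4) = (Re s + Im s)/√2, which is positive by assumption.
    have h2 : Real.cos (s.arg - Real.pi / 4) ≤ 0 :=
      Real.cos_nonpos_of_pi_div_two_le_of_le (by linarith) (by linarith)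
    rw [Real.cos_sub, Complex.cos_arg hs0, Complex.sin_arg, Real.cos_pi_div_four,
      Real.sin_pi_div_four] at h2
    have hn : 0 < ‖s‖ := norm_pos_iff.mpr hs0
    have h3 : s.re / ‖s‖ * (√2 / 2) + s.im / ‖s‖ * (√2 / 2) =
      (s.re + s.im) / ‖s‖ * (√2 / 2) := by ring
    rw [h3] at h2
    have : 0 < (s.re + s.im) / ‖s‖ * (√2 / 2) := by positivity
    linarith
  refine Real.cos_le_cos_of_nonneg_of_le_pi (by positivity) (by linarith [Real.pi_pos]) ?_
  nlinarith [Real.pi_pos]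

lemma cos_arg_mul_ge_of_re_pos {ν : ℝ} (hν : 0 < ν) (hν' : ν ≤ 1 / 2) {s : ℂ}
    (h : 0 < s.re) : Real.cos (3 * Real.pi / 8) ≤ Real.cos (Complex.arg s * ν) := by
  have ha := Complex.abs_arg_le_pi_div_two_iff.mpr h.le
  rw [← Real.cos_abs (s.arg * ν), abs_mul, abs_of_pos hν]
  refine Real.cos_le_cos_of_nonneg_of_le_pi (by positivity) (by linarith [Real.pi_pos]) ?_
  nlinarith [Real.pi_pos, abs_nonneg s.arg]

/-- A continuous function which decays at infinity faster than `r⁻²`. -/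
lemma exists_le_div_sq {g : ℝ → ℝ} (hg : ContinuousOn g (Ioi 0))
    (hlim : Tendsto (fun r => r ^ 2 * g r) atTop (𝓝 0)) {r₀ : ℝ} (hr₀ : 0 < r₀) :
    ∃ C, 0 ≤ C ∧ ∀ r, r₀ ≤ r → g r ≤ C / r ^ 2 := by
  obtain ⟨R, hR⟩ := eventually_atTop.mp (hlim.eventually_le_const one_pos)
  have hc : ContinuousOn (fun r => r ^ 2 * g r) (Icc r₀ (max r₀ R)) :=
    (continuous_pow 2).continuousOn.mul (hg.mono fun r hr => hr₀.trans_le hr.1)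
  obtain ⟨C, hC⟩ := (isCompact_Icc.image_of_continuousOn hc).bddAbove
  refine ⟨max C 1, by positivity, fun r hr => ?_⟩
  have hr0 : 0 < r := hr₀.trans_le hr
  rw [le_div_iff₀ (by positivity), mul_comm]
  rcases le_total r (max r₀ R) with h | h
  · exact (hC ⟨r, ⟨hr, h⟩, rfl⟩).trans (le_max_left _ _)
  · exact (hR r ((le_max_right _ _).trans h)).trans (le_max_right _ _)

lemma continuousOn_rpow_const_Ioi (p : ℝ) : ContinuousOn (fun r : ℝ => r ^ p) (Ioi 0) :=
  fun _ hr => (Real.continuousAt_rpow_const _ _ (Or.inl (ne_of_gt hr))).continuousWithinAt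

lemma tendsto_rpow_mul_exp_neg_rpow {a ν : ℝ} (ha : 0 < a) (hν : 0 < ν) (p : ℝ) :
    Tendsto (fun r : ℝ => r ^ p * Real.exp (-a * r ^ ν)) atTop (𝓝 0) := by
  have h := (tendsto_rpow_mul_exp_neg_mul_atTop_nhds_zero (p / ν) a ha).comp
    (tendsto_rpow_atTop hν)
  refine h.congr' ?_
  filter_upwards [eventually_gt_atTop 0] with r hr
  simp only [Function.comp]
  rw [← Real.rpow_mul hr.le, mul_div_cancel₀ _ hν.ne']

lemma exists_rpow_mul_exp_neg_le {a ν : ℝ} (ha : 0 < a) (hν : 0 < ν) (μ : ℝ) {r₀ : ℝ}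
    (hr₀ : 0 < r₀) :
    ∃ C, 0 ≤ C ∧ ∀ r, r₀ ≤ r → r ^ (-μ) * Real.exp (-a * r ^ ν) ≤ C / r ^ 2 := by
  refine exists_le_div_sq ?_ ?_ hr₀
  · exact (continuousOn_rpow_const_Ioi _).mul
      (Real.continuous_exp.comp_continuousOn
        (continuousOn_const.mul (continuousOn_rpow_const_Ioi _)))
  · refine (tendsto_rpow_mul_exp_neg_rpow ha hν (2 - μ)).congr' ?_
    filter_upwards [eventually_gt_atTop 0] with r hr
    rw [sub_eq_add_neg, Real.rpow_add hr, Real.rpow_two]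
    ring

/-- As ν < 1, the term Z r^ν is eventually below (b/2) r; the other half of the linear decay absorbs
the power. -/
lemma exists_rpow_mul_exp_sub_le {b ν : ℝ} (hb : 0 < b) (hν : ν < 1) (μ Z : ℝ) {r₀ : ℝ}
    (hr₀ : 0 < r₀) :
    ∃ C, 0 ≤ C ∧ ∀ r, r₀ ≤ r → r ^ (-μ) * Real.exp (Z * r ^ ν - b * r) ≤ C / r ^ 2 := by
  refine exists_le_div_sq ?_ ?_ hr₀
  · exact (continuousOn_rpow_const_Ioi _).mul
      (Real.continuous_exp.comp_continuousOn
        ((continuousOn_const.mul (continuousOn_rpow_const_Ioi _)).sub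
          (continuousOn_const.mul continuousOn_id)))
  · have h1 := tendsto_rpow_mul_exp_neg_mul_atTop_nhds_zero (2 - μ) (b / 2) (by positivity)
    have h2 : Tendsto (fun r : ℝ => |Z| * r ^ (-(1 - ν))) atTop (𝓝 0) := by
      simpa using (tendsto_rpow_neg_atTop (sub_pos.mpr hν)).const_mul |Z|
    refine squeeze_zero' ?_ ?_ h1
    · filter_upwards [eventually_gt_atTop 0] with r hr
      positivity
    · filter_upwards [eventually_gt_atTop 0, h2.eventually_le_const (half_pos hb)] with r hr h
      rw [← mul_assoc, sub_eq_add_neg 2, Real.rpow_add hr, Real.rpow_two]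
      gcongr
      have e : r ^ ν = r ^ (-(1 - ν)) * r := by
        nth_rewrite 3 [← Real.rpow_one r]
        rw [← Real.rpow_add hr]; congr 1; ring
      have : Z * r ^ ν ≤ b / 2 * r := by
        calc Z * r ^ ν ≤ |Z| * r ^ ν := by gcongr; exact le_abs_self Z
          _ = (|Z| * r ^ (-(1 - ν))) * r := by rw [e]; ring
          _ ≤ b / 2 * r := by gcongr
      linarith

/-! ### The integral along the Bromwich line -/

lemma norm_sq_one_add_mul_I (y : ℝ) : ‖(1 + y * Complex.I : ℂ)‖ ^ 2 = 1 + y ^ 2 := by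
  rw [← Complex.normSq_eq_norm_sq, Complex.normSq_apply]; simp; ring

lemma one_le_norm_one_add_mul_I (y : ℝ) : 1 ≤ ‖(1 + y * Complex.I : ℂ)‖ := by
  have := norm_sq_one_add_mul_I y
  nlinarith [norm_nonneg (1 + y * Complex.I : ℂ), sq_nonneg y]

lemma one_add_mul_I_mem_slitPlane (y : ℝ) : (1 + y * Complex.I : ℂ) ∈ Complex.slitPlane :=
  Or.inl (by simp)

lemma continuous_wrightKernel_line (μ ν z t : ℝ) :
    Continuous fun y : ℝ => wrightKernel μ ν z t (1 + y * Complex.I) :=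
  (continuousOn_wrightKernel μ ν z t).comp_continuous (by fun_prop) one_add_mul_I_mem_slitPlane

lemma integrable_of_norm_le_div_one_add_sq {f : ℝ → ℂ} (hf : Continuous f) {C : ℝ}
    (h : ∀ y, ‖f y‖ ≤ C / (1 + y ^ 2)) : Integrable f := by
  refine (integrable_inv_one_add_sq.const_mul C).mono' hf.aestronglyMeasurable
    (Eventually.of_forall fun y => ?_)
  simpa [div_eq_mul_inv] using h y

lemma integrableOn_of_norm_le_div_one_add_sq {f : ℝ → ℂ} (hf : ContinuousOn f (Ioi 0)) {C : ℝ}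
    (h : ∀ y, 0 < y → ‖f y‖ ≤ C / (1 + y ^ 2)) : IntegrableOn f (Ioi 0) := by
  refine (integrable_inv_one_add_sq.const_mul C).integrableOn.mono'
    (hf.aestronglyMeasurable measurableSet_Ioi) ?_
  filter_upwards [ae_restrict_mem measurableSet_Ioi] with y hy
  simpa [div_eq_mul_inv] using h y hy

/-- Bounds for the kernel in the sector where `s ^ ν` has a positive real part. -/
lemma exists_norm_wrightKernel_neg_le {ν : ℝ} (hν : 0 < ν) (μ : ℝ) {a₀ r₀ : ℝ}
    (ha₀ : 0 < a₀) (hr₀ : 0 < r₀) :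
    ∃ C, 0 ≤ C ∧ ∀ a t s, a₀ ≤ a → r₀ ≤ ‖s‖ →
      Real.cos (3 * Real.pi / 8) ≤ Real.cos (Complex.arg s * ν) →
      ‖wrightKernel μ ν (-a) t s‖ ≤ Real.exp (s.re * t) *
        Real.exp (-(a - a₀) * (r₀ ^ ν * Real.cos (3 * Real.pi / 8))) * (C / ‖s‖ ^ 2) := by
  set κ := Real.cos (3 * Real.pi / 8) with hκ
  have hκ0 : 0 < κ := cos_three_pi_div_eight_pos
  obtain ⟨C, hC0, hC⟩ := exists_rpow_mul_exp_neg_le (mul_pos ha₀ hκ0) hν μ hr₀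
  refine ⟨C, hC0, fun a t s ha hs hcos => ?_⟩
  rw [norm_wrightKernel, mul_assoc, mul_assoc]
  refine mul_le_mul_of_nonneg_left ?_ (Real.exp_pos _).le
  have h1 : r₀ ^ ν ≤ ‖s‖ ^ ν := Real.rpow_le_rpow hr₀.le hs hν.le
  -- Splitting a = (a - a₀) + a₀: the first summand gives exponential decay in a, the second gives
  -- decay in s.
  have h2 : -a * (‖s‖ ^ ν * Real.cos (Complex.arg s * ν)) ≤
      -(a - a₀) * (r₀ ^ ν * κ) + -(a₀ * κ) * ‖s‖ ^ ν := by
    have h3 : ‖s‖ ^ ν * κ ≤ ‖s‖ ^ ν * Real.cos (Complex.arg s * ν) := by gcongr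
    have h4 : r₀ ^ ν * κ ≤ ‖s‖ ^ ν * κ := by gcongr
    have h5 : a * (‖s‖ ^ ν * κ) ≤ a * (‖s‖ ^ ν * Real.cos (Complex.arg s * ν)) :=
      mul_le_mul_of_nonneg_left h3 (ha₀.le.trans ha)
    have h6 : (a - a₀) * (r₀ ^ ν * κ) ≤ (a - a₀) * (‖s‖ ^ ν * κ) :=
      mul_le_mul_of_nonneg_left h4 (sub_nonneg.mpr ha)
    linarith
  calc ‖s‖ ^ (-μ) * Real.exp (-a * (‖s‖ ^ ν * Real.cos (Complex.arg s * ν)))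
      ≤ ‖s‖ ^ (-μ) * Real.exp (-(a - a₀) * (r₀ ^ ν * κ) + -(a₀ * κ) * ‖s‖ ^ ν) := by gcongr
    _ = Real.exp (-(a - a₀) * (r₀ ^ ν * κ)) *
        (‖s‖ ^ (-μ) * Real.exp (-(a₀ * κ) * ‖s‖ ^ ν)) := by rw [Real.exp_add]; ring
    _ ≤ _ := by gcongr; exact hC _ hs

lemma exists_norm_wrightKernel_line_le {ν : ℝ} (hν : 0 < ν) (hν' : ν ≤ 1 / 2) (μ : ℝ) {a₀ : ℝ}
    (ha₀ : 0 < a₀) :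
    ∃ C, 0 ≤ C ∧ ∀ a t y : ℝ, a₀ ≤ a →
      ‖wrightKernel μ ν (-a) t (1 + y * Complex.I)‖ ≤ Real.exp t *
        Real.exp (-(a - a₀) * Real.cos (3 * Real.pi / 8)) * (C / (1 + y ^ 2)) := by
  obtain ⟨C, hC0, hC⟩ := exists_norm_wrightKernel_neg_le hν μ ha₀ one_pos
  refine ⟨C, hC0, fun a t y ha => ?_⟩
  have := hC a t (1 + y * Complex.I) ha (one_le_norm_one_add_mul_I y)
    (cos_arg_mul_ge_of_re_pos hν hν' (by simp))
  rw [norm_sq_one_add_mul_I] at this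
  simpa using this

lemma integrable_wrightKernel_line {ν : ℝ} (hν : 0 < ν) (hν' : ν ≤ 1 / 2) (μ : ℝ) {a : ℝ}
    (ha : 0 < a) (t : ℝ) :
    Integrable fun y : ℝ => wrightKernel μ ν (-a) t (1 + y * Complex.I) := by
  obtain ⟨C, hC0, hC⟩ := exists_norm_wrightKernel_line_le hν hν' μ ha
  refine integrable_of_norm_le_div_one_add_sq (continuous_wrightKernel_line _ _ _ _)
    (C := Real.exp t * C) fun y => (hC a t y le_rfl).trans (le_of_eq ?_)
  simp; ring

/-- The lower half of the line contributes the conjugate of the upper half, and Re X = Im(iX). The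
factor `Complex.I` makes the right side an integral with respect to ds along a ray from 1, which can
then be rotated. -/
lemma integral_wrightKernel_line_re {μ ν z t : ℝ}
    (h : Integrable fun y : ℝ => wrightKernel μ ν z t (1 + y * Complex.I)) :
    (∫ y : ℝ, wrightKernel μ ν z t (1 + y * Complex.I)).re =
      2 * (∫ y : ℝ in Ioi 0, Complex.I * wrightKernel μ ν z t (1 + y * Complex.I)).im := by
  rw [← integral_add_compl (measurableSet_Ioi (a := (0 : ℝ))) h, compl_Ioi,
    ← neg_zero, ← integral_comp_neg_Ioi, neg_zero]
  have : ∀ y : ℝ, wrightKernel μ ν z t (1 + ((-y : ℝ) : ℂ) * Complex.I) =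
      starRingEnd ℂ (wrightKernel μ ν z t (1 + y * Complex.I)) := fun y => by
    rw [← wrightKernel_conj _ _ _ _ (one_add_mul_I_mem_slitPlane y)]
    congr 1; simp
  simp only [this]
  rw [integral_conj, integral_const_mul]
  simp; ring

lemma auxR_eq_integral (μ ν : ℝ) {a : ℝ} (ha : 0 < a) (t : ℝ) :
    auxR μ ν a t = 1 / (2 * Real.pi) *
      (∫ y : ℝ, wrightKernel μ ν (-a) t (1 + y * Complex.I)).re := by
  rw [auxR, if_neg ha.ne', inverseLaplace]
  have : (1 / (2 * (Real.pi : ℂ))) = ((1 / (2 * Real.pi) : ℝ) : ℂ) := by push_cast; rfl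
  rw [this, Complex.re_ofReal_mul]
  congr 3
  ext y
  simp only [wrightKernel]; push_cast; ring_nf

lemma auxR_eq_integral_Ioi {ν : ℝ} (hν : 0 < ν) (hν' : ν ≤ 1 / 2) (μ : ℝ) {a : ℝ}
    (ha : 0 < a) (t : ℝ) :
    auxR μ ν a t = 1 / Real.pi *
      (∫ y : ℝ in Ioi 0, Complex.I * wrightKernel μ ν (-a) t (1 + y * Complex.I)).im := by
  rw [auxR_eq_integral μ ν ha,
    integral_wrightKernel_line_re (integrable_wrightKernel_line hν hν' μ ha t)]
  field_simp

/-- The exponential decay in a serves twice: for the limit a → ∞ and for integrability in space. -/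
lemma exists_abs_auxR_le {ν : ℝ} (hν : 0 < ν) (hν' : ν ≤ 1 / 2) (μ : ℝ) {a₀ : ℝ} (ha₀ : 0 < a₀) :
    ∃ C, 0 ≤ C ∧ ∀ a t, a₀ ≤ a → |auxR μ ν a t| ≤
      C * Real.exp t * Real.exp (-(a - a₀) * Real.cos (3 * Real.pi / 8)) := by
  obtain ⟨C, hC0, hC⟩ := exists_norm_wrightKernel_line_le hν hν' μ ha₀
  refine ⟨1 / (2 * Real.pi) * (C * Real.pi), by positivity, fun a t ha => ?_⟩
  rw [auxR_eq_integral μ ν (ha₀.trans_le ha), abs_mul,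
    abs_of_pos (show 0 < 1 / (2 * Real.pi) by positivity)]
  have : ‖∫ y : ℝ, wrightKernel μ ν (-a) t (1 + y * Complex.I)‖ ≤
      ∫ y : ℝ, (Real.exp t * Real.exp (-(a - a₀) * Real.cos (3 * Real.pi / 8)) * C) *
        (1 + y ^ 2)⁻¹ := by
    refine norm_integral_le_of_norm_le (integrable_inv_one_add_sq.const_mul _)
      (Eventually.of_forall fun y => (hC a t y ha).trans (le_of_eq (by ring)))
  rw [integral_const_mul, integral_univ_inv_one_add_sq] at this
  have h2 := mul_le_mul_of_nonneg_left ((Complex.abs_re_le_norm _).trans this)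
    (show 0 ≤ 1 / (2 * Real.pi) by positivity)
  exact h2.trans (le_of_eq (by ring))

lemma tendsto_auxR_atTop {ν : ℝ} (hν : 0 < ν) (hν' : ν ≤ 1 / 2) (μ t : ℝ) :
    Tendsto (fun a => auxR μ ν a t) atTop (𝓝 0) := by
  obtain ⟨C, hC0, hC⟩ := exists_abs_auxR_le hν hν' μ one_pos
  have hκ := cos_three_pi_div_eight_pos
  have h1 : Tendsto (fun a : ℝ => (a - 1) * Real.cos (3 * Real.pi / 8)) atTop atTop :=
    (tendsto_atTop_add_const_right _ (-1 : ℝ) tendsto_id).atTop_mul_const hκ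
  have h2 := (Real.tendsto_exp_neg_atTop_nhds_zero.comp h1).const_mul (C * Real.exp t)
  rw [mul_zero] at h2
  refine squeeze_zero_norm' ?_ h2
  filter_upwards [eventually_ge_atTop 1] with a ha
  refine (hC a t ha).trans (le_of_eq ?_)
  simp only [Function.comp_apply, neg_mul]

/-! ### Vanishing at nonpositive times -/

lemma ray_I_mem_upperSlit (ρ : ℝ) (hρ : 0 ≤ ρ) : 1 + ρ * Complex.I ∈ upperSlit := by
  rcases hρ.eq_or_lt with rfl | h
  · right; simp
  · left; simpa using h

lemma ray_one_mem_upperSlit (ρ : ℝ) (hρ : 0 ≤ ρ) : 1 + ρ * (1 : ℂ) ∈ upperSlit := by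
  right; simp; linarith

lemma mem_segment_re_im {R : ℝ} {d₁ d₂ s : ℂ} (hs : s ∈ segment ℝ (1 + R * d₁) (1 + R * d₂)) :
    ∃ u v : ℝ, 0 ≤ u ∧ 0 ≤ v ∧ u + v = 1 ∧ s.re = 1 + R * (u * d₁.re + v * d₂.re) ∧
      s.im = R * (u * d₁.im + v * d₂.im) := by
  obtain ⟨u, v, hu, hv, huv, rfl⟩ := hs
  refine ⟨u, v, hu, hv, huv, ?_, ?_⟩
  · simp; linear_combination huv
  · simp; ring

/-- The inverse Laplace transform vanishes at nonpositive times. -/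
lemma auxR_of_nonpos {ν : ℝ} (hν : 0 < ν) (hν' : ν ≤ 1 / 2) (μ : ℝ) {a : ℝ}
    (ha : 0 < a) {t : ℝ} (ht : t ≤ 0) : auxR μ ν a t = 0 := by
  obtain ⟨C, hC0, hC⟩ := exists_norm_wrightKernel_neg_le hν μ ha (r₀ := 1 / 2) (by norm_num)
  have hb : ∀ s : ℂ, 1 ≤ s.re → ‖wrightKernel μ ν (-a) t s‖ ≤ C / ‖s‖ ^ 2 := fun s hs => by
    have h1 : s.re ≤ ‖s‖ := Complex.re_le_norm s
    have := hC a t s le_rfl (by linarith) (cos_arg_mul_ge_of_re_pos hν hν' (by linarith))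
    refine this.trans ?_
    have h2 : Real.exp (s.re * t) ≤ 1 := Real.exp_le_one_iff.mpr (by nlinarith)
    simp only [sub_self, neg_zero, zero_mul, Real.exp_zero, mul_one]
    exact mul_le_of_le_one_left (by positivity) h2
  have hray : IntegrableOn (fun ρ : ℝ => 1 * wrightKernel μ ν (-a) t (1 + ρ * 1)) (Ioi 0) := by
    refine integrableOn_of_norm_le_div_one_add_sq (C := C) ?_ ?_
    · refine continuousOn_const.mul ((continuousOn_wrightKernel _ _ _ _).comp (by fun_prop)
        fun ρ hρ => upperSlit_subset_slitPlane (ray_one_mem_upperSlit ρ (le_of_lt hρ)))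
    · intro y hy
      rw [one_mul]
      refine (hb _ (by simp; exact hy.le)).trans ?_
      gcongr
      have : ‖(1 + y * 1 : ℂ)‖ = 1 + y := by
        rw [mul_one, show (1 + y : ℂ) = ((1 + y : ℝ) : ℂ) by push_cast; rfl, Complex.norm_real,
          Real.norm_of_nonneg (by positivity)]
      rw [this]; nlinarith
  have hI : IntegrableOn (fun y : ℝ => Complex.I * wrightKernel μ ν (-a) t (1 + y * Complex.I))
      (Ioi 0) := ((integrable_wrightKernel_line hν hν' μ ha t).const_mul _).integrableOn
  -- For t ≤ 0 the factor e^{st} is bounded by 1 to the right, so the ray can be turned onto the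
  -- real axis. The kernel is real there, and the imaginary part of the integral is 0.
  rw [auxR_eq_integral_Ioi hν hν' μ ha,
    integral_ray_eq_of_segment_bound (C := 4 * C) (differentiableOn_wrightKernel μ ν (-a) t)
      ray_I_mem_upperSlit ray_one_mem_upperSlit hI hray]
  · have : ∀ ρ : ℝ, ρ ∈ Ioi (0 : ℝ) → (1 : ℂ) * wrightKernel μ ν (-a) t (1 + ρ * 1) =
        (((wrightKernel μ ν (-a) t (1 + ρ * 1)).re : ℝ) : ℂ) := fun ρ hρ => by
      have h := wrightKernel_im_of_pos μ ν (-a) t (x := 1 + ρ) (by have := mem_Ioi.mp hρ; linarith)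
      apply Complex.ext
      · simp
      · simpa using h
    rw [setIntegral_congr_fun measurableSet_Ioi this, integral_complex_ofReal]
    simp
  · intro R hR s hs
    obtain ⟨u, v, hu, hv, huv, hre, him⟩ := mem_segment_re_im hs
    simp only [Complex.I_re, Complex.I_im, Complex.one_re, Complex.one_im] at hre him
    have h1 : 1 ≤ s.re := by rw [hre]; nlinarith
    refine (hb s h1).trans ?_
    rw [div_le_div_iff₀ (pow_pos (by linarith [Complex.re_le_norm s]) 2) (by positivity)]
    -- Here s = 1 + Rv + iRu with u + v = 1, so ‖s‖² ≥ R²(u² + v²) ≥ R²/2.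
    have : R ^ 2 ≤ 4 * ‖s‖ ^ 2 := by
      rw [← Complex.normSq_eq_norm_sq, Complex.normSq_apply, hre, him]
      have hu' : u = 1 - v := by linarith
      subst hu'
      nlinarith [sq_nonneg (1 - 2 * v), mul_nonneg hv (by linarith : (0 : ℝ) ≤ R), sq_nonneg R,
        mul_nonneg (sq_nonneg R) (sq_nonneg (1 - 2 * v))]
    nlinarith

/-! ### The Laplace transform of a power and its inversion -/

lemma integrableOn_rpow_mul_exp_neg_mul {b p : ℝ} (hp : -1 < p) (hb : 0 < b) :
    IntegrableOn (fun x : ℝ => x ^ p * Real.exp (-b * x)) (Ioi 0) := by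
  simpa using integrableOn_rpow_mul_exp_neg_mul_rpow hp one_pos hb

lemma norm_rpow_mul_cexp {β σ : ℝ} (hσ : 0 < σ) (s : ℂ) :
    ‖((σ ^ (β - 1) : ℝ) : ℂ) * Complex.exp (-s * σ)‖ = σ ^ (β - 1) * Real.exp (-s.re * σ) := by
  rw [norm_mul, Complex.norm_real, Real.norm_of_nonneg (by positivity), Complex.norm_exp]
  simp

lemma integrableOn_rpow_mul_cexp {β : ℝ} (hβ : 0 < β) {s : ℂ} (hs : 0 < s.re) :
    IntegrableOn (fun σ : ℝ => ((σ ^ (β - 1) : ℝ) : ℂ) * Complex.exp (-s * σ)) (Ioi 0) := by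
  refine (integrableOn_rpow_mul_exp_neg_mul (p := β - 1) (by linarith) hs).mono' ?_ ?_
  · refine ContinuousOn.aestronglyMeasurable ?_ measurableSet_Ioi
    exact (Complex.continuous_ofReal.comp_continuousOn (continuousOn_rpow_const_Ioi _)).mul
      (by fun_prop)
  · filter_upwards [ae_restrict_mem measurableSet_Ioi] with σ hσ
    exact (norm_rpow_mul_cexp hσ s).le

lemma differentiableAt_integral_rpow_mul_cexp {β : ℝ} (hβ : 0 < β) {s : ℂ} (hs : 0 < s.re) :
    DifferentiableAt ℂ
      (fun s : ℂ => ∫ σ : ℝ in Ioi 0, ((σ ^ (β - 1) : ℝ) : ℂ) * Complex.exp (-s * σ)) s := by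
  have hmeas : ∀ (g : ℝ → ℂ), Continuous g → AEStronglyMeasurable
      (fun σ : ℝ => ((σ ^ (β - 1) : ℝ) : ℂ) * g σ) (volume.restrict (Ioi 0)) := fun g hg =>
    ((Complex.continuous_ofReal.comp_continuousOn (continuousOn_rpow_const_Ioi _)).mul
      hg.continuousOn).aestronglyMeasurable measurableSet_Ioi
  have hball : {z : ℂ | s.re / 2 < z.re} ∈ 𝓝 s :=
    (isOpen_lt continuous_const Complex.continuous_re).mem_nhds (by simp; linarith)
  refine (hasDerivAt_integral_of_dominated_loc_of_deriv_le (μ := volume.restrict (Ioi 0))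
    (F := fun (z : ℂ) (σ : ℝ) => ((σ ^ (β - 1) : ℝ) : ℂ) * Complex.exp (-z * σ))
    (F' := fun z σ => ((σ ^ (β - 1) : ℝ) : ℂ) * (Complex.exp (-z * σ) * (-σ)))
    (bound := fun σ => σ ^ β * Real.exp (-(s.re / 2) * σ)) hball
    (Eventually.of_forall fun z => hmeas _ (by fun_prop)) (integrableOn_rpow_mul_cexp hβ hs)
    (hmeas _ (by fun_prop)) ?_
    (integrableOn_rpow_mul_exp_neg_mul (by linarith) (by linarith)) ?_).2.differentiableAt
  · filter_upwards [ae_restrict_mem measurableSet_Ioi] with σ hσ z hz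
    have hσ0 : (0 : ℝ) < σ := hσ
    rw [← mul_assoc, norm_mul, norm_rpow_mul_cexp hσ0, norm_neg, Complex.norm_real,
      Real.norm_of_nonneg hσ0.le, mul_right_comm, Real.rpow_sub_one hσ0.ne',
      div_mul_cancel₀ _ hσ0.ne']
    have : s.re / 2 < z.re := hz
    gcongr
  · filter_upwards with σ z _
    have : HasDerivAt (fun z : ℂ => -z * σ) (-σ : ℂ) z := by
      simpa using (hasDerivAt_id z).neg.mul_const (σ : ℂ)
    exact this.cexp.const_mul _

/-- The Laplace transform of a power. -/
lemma integral_rpow_mul_cexp_neg {β : ℝ} (hβ : 0 < β) {s : ℂ} (hs : 0 < s.re) :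
    ∫ σ : ℝ in Ioi 0, ((σ ^ (β - 1) : ℝ) : ℂ) * Complex.exp (-s * σ) =
      Real.Gamma β * s ^ (-(β : ℂ)) := by
  have hopen : IsOpen {z : ℂ | 0 < z.re} := isOpen_lt continuous_const Complex.continuous_re
  have h1 : AnalyticOnNhd ℂ
      (fun s : ℂ => ∫ σ : ℝ in Ioi 0, ((σ ^ (β - 1) : ℝ) : ℂ) * Complex.exp (-s * σ))
      {z : ℂ | 0 < z.re} :=
    DifferentiableOn.analyticOnNhd (fun z hz =>
      (differentiableAt_integral_rpow_mul_cexp hβ hz).differentiableWithinAt) hopen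
  have h2 : AnalyticOnNhd ℂ (fun s : ℂ => Real.Gamma β * s ^ (-(β : ℂ))) {z : ℂ | 0 < z.re} :=
    DifferentiableOn.analyticOnNhd (fun z hz =>
      (((hasDerivAt_id z).cpow_const (c := -(β : ℂ)) (Or.inl hz)).const_mul
        _).differentiableAt.differentiableWithinAt) hopen
  have hconv : Convex ℝ {z : ℂ | 0 < z.re} := convex_halfSpace_re_gt 0
  -- Identity theorem: both sides are analytic for Re s > 0 and agree on the positive axis, in
  -- particular at the points 1 + 1/(n+1), which accumulate at 1.
  refine h1.eqOn_of_preconnected_of_frequently_eq h2 hconv.isPreconnected (z₀ := 1) (by simp) ?_ hs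
  have hreal : ∀ x : ℝ, 0 < x →
      ∫ σ : ℝ in Ioi 0, ((σ ^ (β - 1) : ℝ) : ℂ) * Complex.exp (-(x : ℂ) * σ) =
      Real.Gamma β * (x : ℂ) ^ (-(β : ℂ)) := fun x hx => by
    have := Real.integral_rpow_mul_exp_neg_mul_Ioi hβ hx
    have e : ∀ σ : ℝ, ((σ ^ (β - 1) : ℝ) : ℂ) * Complex.exp (-(x : ℂ) * σ) =
        ((σ ^ (β - 1) * Real.exp (-(x * σ)) : ℝ) : ℂ) := fun σ => by push_cast; ring_nf
    simp only [e]
    rw [integral_complex_ofReal, this, one_div, Real.inv_rpow hx.le, ← Real.rpow_neg hx.le]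
    push_cast
    rw [Complex.ofReal_cpow hx.le]; push_cast; ring
  have ht : Tendsto (fun n : ℕ => ((1 + 1 / ((n : ℝ) + 1) : ℝ) : ℂ)) atTop (𝓝[≠] 1) := by
    refine tendsto_nhdsWithin_iff.mpr ⟨?_, Eventually.of_forall fun n => ?_⟩
    · have := tendsto_one_div_add_atTop_nhds_zero_nat (𝕜 := ℝ)
      have := (Complex.continuous_ofReal.tendsto _).comp (this.const_add 1)
      simpa [Function.comp_def] using this
    · have : (0 : ℝ) < 1 / ((n : ℝ) + 1) := by positivity
      rw [mem_compl_singleton_iff]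
      intro h
      have h' : (1 + 1 / ((n : ℝ) + 1) : ℝ) = 1 := by exact_mod_cast h
      linarith
  exact ht.frequently (Frequently.of_forall fun n => hreal _ (by positivity))

/-- The inverse Laplace transform of a power. -/
lemma integral_wrightKernel_line_zero {μ : ℝ} (hμ : 2 ≤ μ) (ν : ℝ) {t : ℝ} (ht : 0 < t) :
    Integrable (fun y : ℝ => wrightKernel μ ν 0 t (1 + y * Complex.I)) ∧
    ∫ y : ℝ, wrightKernel μ ν 0 t (1 + y * Complex.I) =
      ((2 * Real.pi * (t ^ (μ - 1) / Real.Gamma μ) : ℝ) : ℂ) := by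
  have hG : 0 < Real.Gamma μ := Real.Gamma_pos_of_pos (by linarith)
  set g : ℝ → ℂ := fun y => (1 + y * Complex.I : ℂ) ^ (-(μ : ℂ)) with hg
  have hgc : Continuous g := by
    refine Continuous.cpow (by fun_prop) continuous_const one_add_mul_I_mem_slitPlane
  have hgi : Integrable g := by
    refine integrable_of_norm_le_div_one_add_sq hgc (C := 1) fun y => ?_
    have h : (-(μ : ℂ)) = ((-μ : ℝ) : ℂ) := by push_cast; rfl
    simp only [hg]
    rw [h, Complex.norm_cpow_real, ← norm_sq_one_add_mul_I, one_div, ← Real.rpow_two,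
      ← Real.rpow_neg (norm_nonneg _)]
    exact Real.rpow_le_rpow_of_exponent_le (one_le_norm_one_add_mul_I y) (by linarith)
  have hker : ∀ y : ℝ, wrightKernel μ ν 0 t (1 + y * Complex.I) =
      Real.exp t * (Complex.exp (y * t * Complex.I) * g y) := fun y => by
    simp only [wrightKernel, hg]
    push_cast
    rw [← mul_assoc, ← Complex.exp_add]
    simp; left; ring_nf
  have hki : Integrable (fun y : ℝ => wrightKernel μ ν 0 t (1 + y * Complex.I)) := by
    simp only [hker]
    refine Integrable.const_mul ?_ _
    refine hgi.bdd_mul (c := 1) (by fun_prop) (Eventually.of_forall fun y => ?_)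
    rw [← Complex.ofReal_mul, Complex.norm_exp_ofReal_mul_I]
  refine ⟨hki, ?_⟩
  -- The function x^{μ-1} e^{-x} / Γ(μ) on x > 0 has the Fourier transform (1 + 2πiw)^{-μ}. This is
  -- integrable because μ ≥ 2, and Fourier inversion at t is the claim.
  set f : ℝ → ℂ := (Ioi (0 : ℝ)).indicator
    fun x => (1 / Real.Gamma μ : ℂ) * (((x ^ (μ - 1) : ℝ) : ℂ) * Complex.exp (-1 * x)) with hf
  have hfi : Integrable f := by
    rw [hf, integrable_indicator_iff measurableSet_Ioi]
    exact (integrableOn_rpow_mul_cexp (by linarith) (by simp)).const_mul _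
  have hfF : FourierTransform.fourier f = fun w : ℝ => g (2 * Real.pi * w) := by
    ext w
    rw [Real.fourier_real_eq_integral_exp_smul]
    have e : ∀ x : ℝ, Complex.exp (((-2 * Real.pi * x * w : ℝ) : ℂ) * Complex.I) • f x =
        (Ioi (0 : ℝ)).indicator (fun x : ℝ => (1 / Real.Gamma μ : ℂ) *
          (((x ^ (μ - 1) : ℝ) : ℂ) *
            Complex.exp (-(1 + ((2 * Real.pi * w : ℝ) : ℂ) * Complex.I) * x))) x := fun x => by
      simp only [hf, smul_eq_mul, indicator_apply]
      split_ifs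
      · rw [mul_left_comm, mul_left_comm (Complex.exp _), ← Complex.exp_add]
        congr 3; push_cast; ring
      · simp
    simp only [e]
    rw [integral_indicator measurableSet_Ioi, integral_const_mul,
      integral_rpow_mul_cexp_neg (by linarith) (by simp)]
    have : (Real.Gamma μ : ℂ) ≠ 0 := by exact_mod_cast hG.ne'
    simp only [hg]
    push_cast
    field_simp
  have hFi : Integrable (FourierTransform.fourier f) := by
    rw [hfF]; exact hgi.comp_mul_left' (by positivity)
  have hfc : ContinuousAt f t := by
    have : ContinuousAt (fun x : ℝ => (1 / Real.Gamma μ : ℂ) *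
        (((x ^ (μ - 1) : ℝ) : ℂ) * Complex.exp (-1 * x))) t := by
      refine continuousAt_const.mul (ContinuousAt.mul ?_ (by fun_prop))
      exact Complex.continuous_ofReal.continuousAt.comp
        (Real.continuousAt_rpow_const _ _ (Or.inl ht.ne'))
    refine this.congr ?_
    filter_upwards [Ioi_mem_nhds ht] with x hx
    simp [hf, indicator_of_mem hx]
  have hinv := hfi.fourierInv_fourier_eq hFi hfc
  rw [hfF, Real.fourierInv_eq_fourier_neg, Real.fourier_real_eq_integral_exp_smul] at hinv
  have e2 : ∀ v : ℝ, Complex.exp (((-2 * Real.pi * v * -t : ℝ) : ℂ) * Complex.I) •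
      g (2 * Real.pi * v) = (fun y : ℝ => Complex.exp (y * t * Complex.I) * g y)
        (2 * Real.pi * v) := fun v => by
    simp only [smul_eq_mul]; congr 2; push_cast; ring
  simp only [e2] at hinv
  rw [Measure.integral_comp_mul_left (fun y : ℝ => Complex.exp (y * t * Complex.I) * g y)] at hinv
  simp only [hker]
  rw [integral_const_mul]
  have h2 : (∫ y : ℝ, Complex.exp (y * t * Complex.I) * g y) = (2 * Real.pi : ℝ) * f t := by
    rw [← hinv, abs_of_pos (by positivity), Complex.real_smul, ← mul_assoc, ← Complex.ofReal_mul,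
      mul_inv_cancel₀ (by positivity)]
    simp
  rw [h2, hf, indicator_of_mem (mem_Ioi.mpr ht)]
  push_cast
  have : Complex.exp t * Complex.exp (-1 * t) = 1 := by rw [← Complex.exp_add]; simp
  linear_combination (2 * Real.pi * (1 / (Real.Gamma μ : ℂ)) * ((t ^ (μ - 1) : ℝ) : ℂ)) * this

/-! ### The Hankel contour -/

/-- The ray `1 + ρ (-1 + i)`. -/
noncomputable def hankelRay (ρ : ℝ) : ℂ := 1 + ρ * (-1 + Complex.I)

lemma hankelRay_re (ρ : ℝ) : (hankelRay ρ).re = 1 - ρ := by simp [hankelRay]; ring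

lemma hankelRay_im (ρ : ℝ) : (hankelRay ρ).im = ρ := by simp [hankelRay]

lemma hankelRay_mem_upperSlit {ρ : ℝ} (hρ : 0 ≤ ρ) : hankelRay ρ ∈ upperSlit := by
  rw [upperSlit, mem_ofPred_eq, hankelRay_re, hankelRay_im]
  rcases hρ.eq_or_lt with rfl | h
  · right; simp
  · left; exact h

lemma hankelRay_mem_slitPlane {ρ : ℝ} (hρ : 0 ≤ ρ) : hankelRay ρ ∈ Complex.slitPlane :=
  upperSlit_subset_slitPlane (hankelRay_mem_upperSlit hρ)

lemma norm_sq_hankelRay (ρ : ℝ) : ‖hankelRay ρ‖ ^ 2 = (1 - ρ) ^ 2 + ρ ^ 2 := by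
  rw [← Complex.normSq_eq_norm_sq, Complex.normSq_apply, hankelRay_re, hankelRay_im]; ring

lemma one_add_sq_le_norm_sq_hankelRay (ρ : ℝ) : (1 + ρ ^ 2) / 4 ≤ ‖hankelRay ρ‖ ^ 2 := by
  -- The difference of the two sides is ((7ρ - 4)² + 5)/28.
  rw [norm_sq_hankelRay]; nlinarith [sq_nonneg (7 * ρ - 4)]

lemma half_le_norm_hankelRay (ρ : ℝ) : 1 / 2 ≤ ‖hankelRay ρ‖ := by
  have := one_add_sq_le_norm_sq_hankelRay ρ
  nlinarith [norm_nonneg (hankelRay ρ), sq_nonneg ρ]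

lemma norm_hankelRay_le {ρ : ℝ} (hρ : 0 ≤ ρ) : ‖hankelRay ρ‖ ≤ 1 + 2 * ρ := by
  have := norm_sq_hankelRay ρ
  refine le_of_sq_le_sq ?_ (by positivity)
  rw [this]; nlinarith

lemma continuous_hankelRay : Continuous hankelRay := by unfold hankelRay; fun_prop

lemma hasDerivAt_hankelRay (ρ : ℝ) : HasDerivAt hankelRay (-1 + Complex.I) ρ := by
  change HasDerivAt (fun ρ : ℝ => 1 + (ρ : ℂ) * (-1 + Complex.I)) _ ρ
  simpa using
    ((Complex.ofRealCLM.hasDerivAt (x := ρ)).mul_const (-1 + Complex.I)).const_add (1 : ℂ)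

lemma continuousOn_wrightKernel_hankelRay (μ ν z t : ℝ) :
    ContinuousOn (fun ρ : ℝ => (-1 + Complex.I) * wrightKernel μ ν z t (hankelRay ρ)) (Ici 0) :=
  continuousOn_const.mul ((continuousOn_wrightKernel μ ν z t).comp continuous_hankelRay.continuousOn
    fun _ hρ => hankelRay_mem_slitPlane hρ)

lemma aestronglyMeasurable_wrightKernel_hankelRay (μ ν z t : ℝ) :
    AEStronglyMeasurable (fun ρ : ℝ => (-1 + Complex.I) * wrightKernel μ ν z t (hankelRay ρ))
      (volume.restrict (Ioi 0)) :=
  ((continuousOn_wrightKernel_hankelRay μ ν z t).mono Ioi_subset_Ici_self).aestronglyMeasurable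
    measurableSet_Ioi

lemma norm_neg_one_add_I_le : ‖(-1 + Complex.I : ℂ)‖ ≤ 2 := by
  refine (norm_add_le _ _).trans ?_
  simp; norm_num

/-- On the Hankel ray, the kernel with all terms of the exponential series of `exp (z s ^ ν)`
replaced by their absolute values is dominated by an integrable function. -/
lemma exists_norm_kernel_mul_exp_le {ν : ℝ} (hν : ν < 1) (μ Z : ℝ) {t : ℝ} (ht : 0 < t) :
    ∃ C, 0 ≤ C ∧ ∀ ρ : ℝ, 0 ≤ ρ →
      ‖(-1 + Complex.I : ℂ)‖ * (Real.exp ((hankelRay ρ).re * t) * ‖hankelRay ρ‖ ^ (-μ) *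
        Real.exp (Z * ‖hankelRay ρ‖ ^ ν)) ≤ C / (1 + ρ ^ 2) := by
  obtain ⟨C, hC0, hC⟩ := exists_rpow_mul_exp_sub_le (half_pos ht) hν μ Z
    (r₀ := 1 / 2) (by norm_num)
  refine ⟨2 * (Real.exp (3 / 2 * t) * (4 * C)), by positivity, fun ρ hρ => ?_⟩
  set r := ‖hankelRay ρ‖ with hr
  have hr0 : 1 / 2 ≤ r := half_le_norm_hankelRay ρ
  -- From r ≤ 1 + 2ρ one gets 1 - ρ ≤ 3/2 - r/2.
  have h1 : Real.exp ((hankelRay ρ).re * t) ≤ Real.exp (3 / 2 * t) * Real.exp (-(t / 2 * r)) := by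
    rw [← Real.exp_add, hankelRay_re]
    gcongr
    have : r ≤ 1 + 2 * ρ := norm_hankelRay_le hρ
    nlinarith
  have hp : 0 ≤ r ^ (-μ) := Real.rpow_nonneg (norm_nonneg _) _
  calc ‖(-1 + Complex.I : ℂ)‖ * (Real.exp ((hankelRay ρ).re * t) * r ^ (-μ) *
        Real.exp (Z * r ^ ν))
      ≤ 2 * (Real.exp (3 / 2 * t) * Real.exp (-(t / 2 * r)) * r ^ (-μ) * Real.exp (Z * r ^ ν)) := by
        gcongr; exact norm_neg_one_add_I_le
    _ = 2 * (Real.exp (3 / 2 * t) * (r ^ (-μ) * Real.exp (Z * r ^ ν - t / 2 * r))) := by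
        rw [sub_eq_add_neg, Real.exp_add]; ring
    _ ≤ 2 * (Real.exp (3 / 2 * t) * (C / r ^ 2)) := by gcongr; exact hC r hr0
    _ ≤ 2 * (Real.exp (3 / 2 * t) * (C / ((1 + ρ ^ 2) / 4))) := by
        gcongr; exact one_add_sq_le_norm_sq_hankelRay ρ
    _ = _ := by field_simp

/-- The decay comes from e^{st} alone, so the sign of z is irrelevant. Uniformity in |z| ≤ Z is what
differentiation under the integral sign needs. -/
lemma exists_norm_wrightKernel_hankelRay_le {ν : ℝ} (hν : ν < 1) (μ Z : ℝ) {t : ℝ} (ht : 0 < t) :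
    ∃ C, 0 ≤ C ∧ ∀ z ρ : ℝ, |z| ≤ Z → 0 ≤ ρ →
      ‖(-1 + Complex.I) * wrightKernel μ ν z t (hankelRay ρ)‖ ≤ C / (1 + ρ ^ 2) := by
  obtain ⟨C, hC0, hC⟩ := exists_norm_kernel_mul_exp_le hν μ Z ht
  refine ⟨C, hC0, fun z ρ hz hρ => le_trans ?_ (hC ρ hρ)⟩
  rw [norm_mul, norm_wrightKernel]
  have hp : 0 ≤ ‖hankelRay ρ‖ ^ ν := Real.rpow_nonneg (norm_nonneg _) _
  gcongr 3
  calc z * (‖hankelRay ρ‖ ^ ν * Real.cos (Complex.arg (hankelRay ρ) * ν))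
      ≤ |z * (‖hankelRay ρ‖ ^ ν * Real.cos (Complex.arg (hankelRay ρ) * ν))| := le_abs_self _
    _ = |z| * (‖hankelRay ρ‖ ^ ν * |Real.cos (Complex.arg (hankelRay ρ) * ν)|) := by
        rw [abs_mul, abs_mul, abs_of_nonneg hp]
    _ ≤ Z * (‖hankelRay ρ‖ ^ ν * 1) := by
        gcongr
        · exact (abs_nonneg z).trans hz
        · exact Real.abs_cos_le_one _
    _ = _ := by rw [mul_one]

lemma integrableOn_wrightKernel_hankelRay {ν : ℝ} (hν : ν < 1) (μ z : ℝ) {t : ℝ} (ht : 0 < t) :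
    IntegrableOn (fun ρ : ℝ => (-1 + Complex.I) * wrightKernel μ ν z t (hankelRay ρ)) (Ioi 0) := by
  obtain ⟨C, -, hC⟩ := exists_norm_wrightKernel_hankelRay_le hν μ |z| ht
  exact integrableOn_of_norm_le_div_one_add_sq
    ((continuousOn_wrightKernel_hankelRay μ ν z t).mono Ioi_subset_Ici_self)
    fun ρ hρ => hC z ρ le_rfl hρ.le

/-- The Hankel-type integral `(1 / 2πi) ∫ exp (s t) s ^ (-μ) exp (z s ^ ν) ds` along the contour
consisting of `hankelRay` and its complex conjugate. -/
noncomputable def hankelIntegral (μ ν z t : ℝ) : ℝ :=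
  1 / Real.pi * (∫ ρ : ℝ in Ioi 0, (-1 + Complex.I) * wrightKernel μ ν z t (hankelRay ρ)).im

/-- The segment joining the points with parameter R is horizontal at height R, hence ‖s‖ ≥ R on it.
A bound in the wedge between the two rays is therefore enough. -/
lemma integral_ray_I_eq_hankelRay {f : ℂ → ℂ} (hf : DifferentiableOn ℂ f Complex.slitPlane)
    (h₁ : IntegrableOn (fun ρ : ℝ => Complex.I * f (1 + ρ * Complex.I)) (Ioi 0))
    (h₂ : IntegrableOn (fun ρ : ℝ => (-1 + Complex.I) * f (hankelRay ρ)) (Ioi 0)) {C : ℝ}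
    (hC0 : 0 ≤ C)
    (hC : ∀ s : ℂ, s.re ≤ 1 → 0 ≤ s.im → 0 < s.re + s.im → 1 ≤ ‖s‖ → ‖f s‖ ≤ C / ‖s‖ ^ 2) :
    ∫ ρ : ℝ in Ioi 0, Complex.I * f (1 + ρ * Complex.I) =
      ∫ ρ : ℝ in Ioi 0, (-1 + Complex.I) * f (hankelRay ρ) := by
  refine integral_ray_eq_of_segment_bound (C := C) hf ray_I_mem_upperSlit
    (fun _ hρ => hankelRay_mem_upperSlit hρ) h₁ h₂ ?_
  intro R hR s hs
  obtain ⟨u, v, hu, hv, huv, hre, him⟩ := mem_segment_re_im hs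
  simp only [Complex.I_re, Complex.I_im, Complex.add_re, Complex.add_im, Complex.neg_re,
    Complex.neg_im, Complex.one_re, Complex.one_im] at hre him
  have him' : s.im = R := by rw [him]; linear_combination R * huv
  have h1 : R ≤ ‖s‖ := by rw [← him']; exact Complex.im_le_norm s
  have hv1 : v ≤ 1 := by linarith
  refine (hC s (by rw [hre]; nlinarith) (by linarith) (by rw [hre, him']; nlinarith)
    (hR.trans h1)).trans ?_
  gcongr

lemma auxR_eq_hankelIntegral {ν : ℝ} (hν : 0 < ν) (hν' : ν ≤ 1 / 2) (μ : ℝ) {a t : ℝ}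
    (ha : 0 < a) (ht : 0 < t) : auxR μ ν a t = hankelIntegral μ ν (-a) t := by
  obtain ⟨C, hC0, hC⟩ := exists_norm_wrightKernel_neg_le hν μ ha one_pos
  rw [auxR_eq_integral_Ioi hν hν' μ ha, hankelIntegral,
    integral_ray_I_eq_hankelRay (C := Real.exp t * C) (differentiableOn_wrightKernel μ ν (-a) t)
      ((integrable_wrightKernel_line hν hν' μ ha t).const_mul _).integrableOn
      (integrableOn_wrightKernel_hankelRay (by linarith) μ (-a) ht) (by positivity)]
  intro s hre him hsum hs
  refine (hC a t s le_rfl hs (cos_arg_mul_ge hν hν' him hsum)).trans ?_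
  simp only [sub_self, neg_zero, zero_mul, Real.exp_zero, mul_one, mul_div_assoc]
  gcongr
  nlinarith

/-- Integration by parts in the Hankel integral. -/
lemma hankelIntegral_parts {ν : ℝ} (hν : ν < 1) (μ z : ℝ) {t : ℝ} (ht : 0 < t) :
    t * hankelIntegral μ ν z t - μ * hankelIntegral (μ + 1) ν z t
      + z * ν * hankelIntegral (μ + 1 - ν) ν z t = 0 := by
  have i1 := integrableOn_wrightKernel_hankelRay hν μ z ht
  have i2 := integrableOn_wrightKernel_hankelRay hν (μ + 1) z ht
  have i3 := integrableOn_wrightKernel_hankelRay hν (μ + 1 - ν) z ht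
  have hderiv : ∀ ρ ∈ Ioi (0 : ℝ), HasDerivAt (fun ρ => wrightKernel μ ν z t (hankelRay ρ))
      (((t : ℂ) * ((-1 + Complex.I) * wrightKernel μ ν z t (hankelRay ρ))
        - (μ : ℂ) * ((-1 + Complex.I) * wrightKernel (μ + 1) ν z t (hankelRay ρ)))
        + (z * ν : ℂ) * ((-1 + Complex.I) * wrightKernel (μ + 1 - ν) ν z t (hankelRay ρ))) ρ :=
    fun ρ hρ => by
      have := (hasDerivAt_wrightKernel (μ := μ) (ν := ν) (z := z) (t := t)
        (hankelRay_mem_slitPlane (le_of_lt hρ))).scomp ρ (hasDerivAt_hankelRay ρ)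
      refine HasDerivAt.congr_deriv this ?_
      simp only [smul_eq_mul]; ring
  have hlim : Tendsto (fun ρ => wrightKernel μ ν z t (hankelRay ρ)) atTop (𝓝 0) := by
    obtain ⟨C, hC0, hC⟩ := exists_norm_wrightKernel_hankelRay_le hν μ |z| ht
    have h0 : Tendsto (fun ρ : ℝ => C / (1 + ρ ^ 2)) atTop (𝓝 0) :=
      tendsto_const_nhds.div_atTop
        (tendsto_atTop_add_const_left _ _ (tendsto_pow_atTop two_ne_zero))
    refine squeeze_zero_norm' ?_ h0
    filter_upwards [eventually_ge_atTop 0] with ρ hρ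
    refine le_trans ?_ (hC z ρ le_rfl hρ)
    rw [norm_mul]
    refine le_mul_of_one_le_left (norm_nonneg _) ?_
    have := Complex.abs_im_le_norm (-1 + Complex.I)
    simpa using this
  have hcont : ContinuousWithinAt (fun ρ => wrightKernel μ ν z t (hankelRay ρ)) (Ici 0) 0 :=
    ((continuousOn_wrightKernel μ ν z t).comp continuous_hankelRay.continuousOn
      fun _ hρ => hankelRay_mem_slitPlane hρ) 0 self_mem_Ici
  have hFTC := integral_Ioi_of_hasDerivAt_of_tendsto hcont hderiv
    (((i1.const_mul _).sub (i2.const_mul _)).add (i3.const_mul _)) hlim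
  rw [integral_add (by exact (i1.const_mul _).sub (i2.const_mul _)) (i3.const_mul _),
    integral_sub (i1.const_mul _) (i2.const_mul _), integral_const_mul (t : ℂ),
    integral_const_mul (μ : ℂ), integral_const_mul (z * ν : ℂ)] at hFTC
  have him := congrArg Complex.im hFTC
  -- The boundary term at ρ = 0 is the kernel at s = 1; it is real and disappears from the imaginary
  -- part.
  have hreal : (wrightKernel μ ν z t (hankelRay 0)).im = 0 := by
    have := wrightKernel_im_of_pos μ ν z t one_pos
    simpa [hankelRay] using this
  have hz : (z * ν : ℂ) = ((z * ν : ℝ) : ℂ) := by push_cast; rfl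
  rw [hz] at him
  simp only [Complex.add_im, Complex.sub_im, Complex.im_ofReal_mul, zero_sub, Complex.neg_im,
    hreal, neg_zero] at him
  simp only [hankelIntegral]
  linear_combination (1 / Real.pi) * him

/-- Hankel's formula for the reciprocal Gamma function. -/
lemma hankelIntegral_zero {ν : ℝ} (hν : ν < 1) (μ : ℝ) {t : ℝ} (ht : 0 < t) :
    hankelIntegral μ ν 0 t = t ^ (μ - 1) / Real.Gamma μ := by
  -- For μ ≥ 2 the Bromwich integral converges absolutely and Fourier inversion applies.
  have base : ∀ μ : ℝ, 2 ≤ μ → hankelIntegral μ ν 0 t = t ^ (μ - 1) / Real.Gamma μ := by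
    intro μ hμ
    obtain ⟨hi, he⟩ := integral_wrightKernel_line_zero hμ ν ht
    have h := integral_wrightKernel_line_re hi
    rw [he, Complex.ofReal_re, integral_ray_I_eq_hankelRay (C := Real.exp t)
      (differentiableOn_wrightKernel μ ν 0 t) (hi.const_mul _).integrableOn
      (integrableOn_wrightKernel_hankelRay hν μ 0 ht) (Real.exp_pos _).le] at h
    · rw [hankelIntegral]
      have hX : (∫ ρ : ℝ in Ioi 0, (-1 + Complex.I) * wrightKernel μ ν 0 t (hankelRay ρ)).im =
        Real.pi * (t ^ (μ - 1) / Real.Gamma μ) := by linarith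
      rw [hX, one_div, inv_mul_cancel_left₀ Real.pi_ne_zero]
    · intro s hre him hsum hs
      rw [norm_wrightKernel, zero_mul, Real.exp_zero, mul_one, div_eq_mul_inv, ← Real.rpow_two,
        ← Real.rpow_neg (norm_nonneg s)]
      gcongr
      nlinarith
  -- With z = 0, integration by parts reads t H(μ) = μ H(μ + 1), the counterpart of Γ(μ + 1) = μ
  -- Γ(μ); each use lowers the admissible order by one.
  have step : ∀ n : ℕ, ∀ μ : ℝ, 2 - (n : ℝ) ≤ μ →
      hankelIntegral μ ν 0 t = t ^ (μ - 1) / Real.Gamma μ := by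
    intro n
    induction n with
    | zero => intro μ hμ; exact base μ (by simpa using hμ)
    | succ n ih =>
      intro μ hμ
      push_cast at hμ
      have h1 := ih (μ + 1) (by linarith)
      have h2 := hankelIntegral_parts hν μ 0 ht
      rw [h1, add_sub_cancel_right] at h2
      have h3 : hankelIntegral μ ν 0 t = μ * (t ^ μ / Real.Gamma (μ + 1)) / t := by
        field_simp; linear_combination h2
      -- At the poles of Γ both sides are 0: the recurrence produces the factor μ = 0 or carries a
      -- zero down, and `Real.Gamma` is 0 there.
      rw [h3, Real.rpow_sub_one ht.ne']
      rcases eq_or_ne μ 0 with rfl | hμ0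
      · simp
      · rw [Real.Gamma_add_one hμ0]
        rcases eq_or_ne (Real.Gamma μ) 0 with hG | hG
        · simp [hG]
        · field_simp
  obtain ⟨n, hn⟩ := exists_nat_ge (2 - μ)
  exact step n μ (by linarith)

/-! ### The Wright function as a Hankel integral -/

/-- Expanding e^{z s^ν} turns the j-th term into a Hankel integral of order μ - νj with z = 0. The
interchange is dominated by the series of absolute values, whose sum e^{|z| ‖s‖^ν} is beaten by
e^{st} since ν < 1. -/
lemma hasSum_hankelIntegral {ν : ℝ} (hν : ν < 1) (μ z : ℝ) {t : ℝ} (ht : 0 < t) :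
    HasSum (fun j : ℕ => z ^ j / (j.factorial : ℝ) *
      (t ^ (μ - ν * j - 1) / Real.Gamma (μ - ν * j))) (hankelIntegral μ ν z t) := by
  set w : ℝ → ℂ := fun ρ => (-1 + Complex.I) *
    (Complex.exp (hankelRay ρ * t) * hankelRay ρ ^ (-(μ : ℂ))) with hw
  have hsum : HasSum (fun j : ℕ => ∫ ρ in Ioi (0 : ℝ), ((z ^ j / (j.factorial : ℝ) : ℝ) : ℂ) *
      ((-1 + Complex.I) * wrightKernel (μ - ν * j) ν 0 t (hankelRay ρ)))
      (∫ ρ in Ioi (0 : ℝ), (-1 + Complex.I) * wrightKernel μ ν z t (hankelRay ρ)) := by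
    obtain ⟨C, hC0, hC⟩ := exists_norm_kernel_mul_exp_le hν μ |z| ht
    have hs0 : ∀ ρ, 0 < ‖hankelRay ρ‖ := fun ρ =>
      lt_of_lt_of_le (by norm_num) (half_le_norm_hankelRay ρ)
    have hbs : ∀ ρ : ℝ, HasSum (fun j : ℕ => ‖(-1 + Complex.I : ℂ)‖ *
        (Real.exp ((hankelRay ρ).re * t) * ‖hankelRay ρ‖ ^ (-μ) *
          ((|z| * ‖hankelRay ρ‖ ^ ν) ^ j / (j.factorial : ℝ))))
        (‖(-1 + Complex.I : ℂ)‖ * (Real.exp ((hankelRay ρ).re * t) * ‖hankelRay ρ‖ ^ (-μ) *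
          Real.exp (|z| * ‖hankelRay ρ‖ ^ ν))) := fun ρ => by
      have := NormedSpace.expSeries_div_hasSum_exp (|z| * ‖hankelRay ρ‖ ^ ν)
      rw [← Real.exp_eq_exp_ℝ] at this
      exact (this.mul_left _).mul_left _
    refine hasSum_integral_of_dominated_convergence (fun j ρ => ‖(-1 + Complex.I : ℂ)‖ *
        (Real.exp ((hankelRay ρ).re * t) * ‖hankelRay ρ‖ ^ (-μ) *
          ((|z| * ‖hankelRay ρ‖ ^ ν) ^ j / (j.factorial : ℝ))))
      (fun j => (aestronglyMeasurable_wrightKernel_hankelRay _ _ _ _).const_mul _) (fun j => ?_)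
      (Eventually.of_forall fun ρ => (hbs ρ).summable) ?_ ?_
    · refine Eventually.of_forall fun ρ => le_of_eq ?_
      rw [norm_mul, norm_mul, norm_wrightKernel, Complex.norm_real, norm_div, norm_pow,
        Real.norm_eq_abs, Real.norm_natCast, zero_mul, Real.exp_zero, mul_one, neg_sub,
        sub_eq_add_neg, Real.rpow_add (hs0 ρ), mul_pow, Real.rpow_mul (hs0 ρ).le, Real.rpow_natCast]
      ring
    · simp only [(hbs _).tsum_eq]
      refine (integrable_inv_one_add_sq.const_mul C).integrableOn.mono' ?_ ?_
      · refine ContinuousOn.aestronglyMeasurable ?_ measurableSet_Ioi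
        have h1 : Continuous fun ρ => ‖hankelRay ρ‖ := continuous_hankelRay.norm
        have h2 : ∀ p : ℝ, Continuous fun ρ => ‖hankelRay ρ‖ ^ p := fun p =>
          h1.rpow_const fun ρ => Or.inl (hs0 ρ).ne'
        have h3 : Continuous fun ρ => (hankelRay ρ).re :=
          Complex.continuous_re.comp continuous_hankelRay
        exact (continuous_const.mul (((Real.continuous_exp.comp (h3.mul continuous_const)).mul
          (h2 _)).mul (Real.continuous_exp.comp (continuous_const.mul (h2 _))))).continuousOn
      · filter_upwards [ae_restrict_mem measurableSet_Ioi] with ρ hρ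
        rw [Real.norm_of_nonneg (by positivity), ← div_eq_mul_inv]
        exact hC ρ (le_of_lt hρ)
    · filter_upwards [ae_restrict_mem measurableSet_Ioi] with ρ hρ
      have hne : hankelRay ρ ≠ 0 := norm_pos_iff.mp (hs0 ρ)
      have := NormedSpace.expSeries_div_hasSum_exp ((z : ℂ) * hankelRay ρ ^ (ν : ℂ))
      rw [← Complex.exp_eq_exp_ℂ] at this
      have := this.mul_left (w ρ)
      have e : w ρ * Complex.exp ((z : ℂ) * hankelRay ρ ^ (ν : ℂ)) =
          (-1 + Complex.I) * wrightKernel μ ν z t (hankelRay ρ) := by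
        simp only [hw, wrightKernel]; ring
      rw [e] at this
      refine this.congr_fun fun j => ?_
      have e1 : hankelRay ρ ^ (-((μ - ν * j : ℝ) : ℂ)) =
          hankelRay ρ ^ (-(μ : ℂ)) * (hankelRay ρ ^ (ν : ℂ)) ^ j := by
        rw [← Complex.cpow_mul_nat, ← Complex.cpow_add _ _ hne]
        congr 1; push_cast; ring
      simp only [hw, wrightKernel, e1]
      push_cast
      rw [zero_mul, Complex.exp_zero]
      ring
  have him := (Complex.hasSum_iff _ _).mp hsum |>.2.mul_left (1 / Real.pi)
  refine him.congr_fun fun j => ?_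
  rw [integral_const_mul, Complex.im_ofReal_mul, ← hankelIntegral_zero hν _ ht, hankelIntegral]
  ring

lemma wrightW_eq_hankelIntegral {ν : ℝ} (hν : ν < 1) (z μ : ℝ) :
    wrightW z (-ν) μ = hankelIntegral μ ν z 1 := by
  rw [← (hasSum_hankelIntegral hν μ z one_pos).tsum_eq, wrightW]
  congr 1; ext j
  rw [Real.one_rpow, show -ν * (j : ℝ) + μ = μ - ν * j by ring]
  field_simp

lemma wrightW_zero (α β : ℝ) : wrightW 0 α β = 1 / Real.Gamma β := by
  rw [wrightW, tsum_eq_single 0]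
  · simp
  · intro j hj; simp [hj]

lemma hankelIntegral_eq_rpow_mul_wrightW {ν : ℝ} (hν : ν < 1) (μ z : ℝ) {t : ℝ} (ht : 0 < t) :
    hankelIntegral μ ν z t = t ^ (μ - 1) * wrightW (z * t ^ (-ν)) (-ν) μ := by
  rw [← (hasSum_hankelIntegral hν μ z ht).tsum_eq, wrightW, ← tsum_mul_left]
  congr 1; ext j
  rw [show -ν * (j : ℝ) + μ = μ - ν * j by ring,
    show μ - ν * (j : ℝ) - 1 = (μ - 1) + (-ν) * j by ring, Real.rpow_add ht,
    Real.rpow_mul ht.le, Real.rpow_natCast, mul_pow]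
  field_simp

/-- The inverse Laplace transform of `s ^ (-μ) * exp (-a s ^ ν)` in terms of the Wright
function. -/
lemma auxR_eq_rpow_mul_wrightW {ν : ℝ} (hν : 0 < ν) (hν' : ν ≤ 1 / 2) (μ : ℝ) {a t : ℝ}
    (ha : 0 ≤ a) (ht : 0 < t) :
    auxR μ ν a t = t ^ (μ - 1) * wrightW (-a * t ^ (-ν)) (-ν) μ := by
  rcases ha.eq_or_lt with rfl | ha
  · simp [auxR, fracDelta, wrightW_zero, div_eq_mul_inv]
  · rw [auxR_eq_hankelIntegral hν hν' μ ha ht,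
      hankelIntegral_eq_rpow_mul_wrightW (by linarith) _ _ ht]

/-- Differentiation in z brings down s^ν, which lowers the order by ν. -/
lemma hasDerivAt_wrightW {ν : ℝ} (hν : ν < 1) (μ z : ℝ) :
    HasDerivAt (fun z => wrightW z (-ν) μ) (wrightW z (-ν) (μ - ν)) z := by
  simp only [wrightW_eq_hankelIntegral hν]
  obtain ⟨C, hC0, hC⟩ := exists_norm_wrightKernel_hankelRay_le hν (μ - ν) (|z| + 1) one_pos
  have h := (hasDerivAt_integral_of_dominated_loc_of_deriv_le
    (μ := volume.restrict (Ioi (0 : ℝ)))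
    (F := fun (z : ℝ) (ρ : ℝ) => (-1 + Complex.I) * wrightKernel μ ν z 1 (hankelRay ρ))
    (F' := fun (z : ℝ) (ρ : ℝ) => (-1 + Complex.I) * wrightKernel (μ - ν) ν z 1 (hankelRay ρ))
    (x₀ := z) (bound := fun ρ => C * (1 + ρ ^ 2)⁻¹) (Metric.ball_mem_nhds z one_pos)
    (Eventually.of_forall fun z => aestronglyMeasurable_wrightKernel_hankelRay _ _ _ _)
    (integrableOn_wrightKernel_hankelRay hν μ z one_pos)
    (aestronglyMeasurable_wrightKernel_hankelRay _ _ _ _) ?_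
    (integrable_inv_one_add_sq.const_mul C).integrableOn ?_).2
  · have := (Complex.imCLM.hasFDerivAt.comp_hasDerivAt z h).const_mul (1 / Real.pi)
    exact this
  · filter_upwards [ae_restrict_mem measurableSet_Ioi] with ρ hρ x hx
    rw [← div_eq_mul_inv]
    refine hC x ρ ?_ (le_of_lt hρ)
    have h1 : |x - z| < 1 := by simpa [Real.dist_eq] using hx
    have h2 := abs_add_le (x - z) z
    rw [sub_add_cancel] at h2
    linarith
  · filter_upwards [ae_restrict_mem measurableSet_Ioi] with ρ hρ x _
    refine HasDerivAt.const_mul _ ?_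
    have hne : hankelRay ρ ≠ 0 :=
      Complex.slitPlane_ne_zero (hankelRay_mem_slitPlane (le_of_lt hρ))
    have h1 : HasDerivAt (fun x : ℝ => (x : ℂ) * hankelRay ρ ^ (ν : ℂ)) (hankelRay ρ ^ (ν : ℂ)) x := by
      simpa using (Complex.ofRealCLM.hasDerivAt (x := x)).mul_const (hankelRay ρ ^ (ν : ℂ))
    have h2 := (h1.cexp).const_mul
      (Complex.exp (hankelRay ρ * (1 : ℝ)) * hankelRay ρ ^ (-(μ : ℂ)))
    refine h2.congr_deriv ?_
    have e : hankelRay ρ ^ (-((μ - ν : ℝ) : ℂ)) =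
        hankelRay ρ ^ (-(μ : ℂ)) * hankelRay ρ ^ (ν : ℂ) := by
      rw [← Complex.cpow_add _ _ hne]; congr 1; push_cast; ring
    rw [wrightKernel, e]
    ring

lemma continuous_wrightW {ν : ℝ} (hν : ν < 1) (μ : ℝ) : Continuous fun z => wrightW z (-ν) μ :=
  continuous_iff_continuousAt.mpr fun z => (hasDerivAt_wrightW hν μ z).continuousAt

lemma tendsto_wrightW_atTop {ν : ℝ} (hν : 0 < ν) (hν' : ν ≤ 1 / 2) (μ : ℝ) :
    Tendsto (fun a => wrightW (-a) (-ν) μ) atTop (𝓝 0) := by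
  refine (tendsto_auxR_atTop hν hν' μ 1).congr' ?_
  filter_upwards [eventually_ge_atTop 0] with a ha
  simp [auxR_eq_rpow_mul_wrightW hν hν' μ ha one_pos]

/-! ### The curve of real exponent and the bounds 0 < W < 1 -/

/-- The logarithm of the modulus of the point with argument `φ` on the curve where
`s - x s ^ ν` is real. -/
noncomputable def realCurveLog (ν x φ : ℝ) : ℝ :=
  Real.log (x * (ν * Real.sinc (ν * φ) / Real.sinc φ)) / (1 - ν)

/-- The curve in the upper half-plane where `s - x s ^ ν` is real. -/
noncomputable def realCurve (ν x φ : ℝ) : ℂ :=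
  Complex.exp (realCurveLog ν x φ + φ * Complex.I)

section
variable {ν x φ : ℝ}

lemma sinc_pos_of_lt_pi (h0 : 0 ≤ φ) (h1 : φ < Real.pi) : 0 < Real.sinc φ := by
  rcases h0.eq_or_lt with rfl | h
  · simp
  · rw [Real.sinc_of_ne_zero h.ne']
    exact div_pos (Real.sin_pos_of_pos_of_lt_pi h h1) h

lemma mul_lt_pi (hν' : ν ≤ 1 / 2) (h0 : 0 ≤ φ) (h1 : φ < Real.pi) :
    ν * φ < Real.pi := by nlinarith [Real.pi_pos]

lemma realCurve_quot_pos (hν : 0 < ν) (hν' : ν ≤ 1 / 2) (hx : 0 < x) (h0 : 0 ≤ φ)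
    (h1 : φ < Real.pi) : 0 < x * (ν * Real.sinc (ν * φ) / Real.sinc φ) := by
  have := sinc_pos_of_lt_pi h0 h1
  have := sinc_pos_of_lt_pi (by positivity : 0 ≤ ν * φ) (mul_lt_pi hν' h0 h1)
  positivity

/-- The quotient on the right has a removable singularity at φ = 0; the form with `Real.sinc`
supplies its value ν there, so the curve includes its starting point on the real axis. -/
lemma realCurve_quot_eq (hν : 0 < ν) (h0 : 0 < φ) :
    ν * Real.sinc (ν * φ) / Real.sinc φ = Real.sin (ν * φ) / Real.sin φ := by
  rw [Real.sinc_of_ne_zero h0.ne', Real.sinc_of_ne_zero (by positivity)]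
  field_simp

lemma realCurve_eq (ν x φ : ℝ) : realCurve ν x φ =
    Real.exp (realCurveLog ν x φ) * (Real.cos φ + Real.sin φ * Complex.I) := by
  rw [realCurve, Complex.exp_add, Complex.exp_mul_I]; push_cast; rfl

lemma realCurve_re (ν x φ : ℝ) :
    (realCurve ν x φ).re = Real.exp (realCurveLog ν x φ) * Real.cos φ := by
  rw [realCurve_eq, Complex.re_ofReal_mul]
  simp [-Complex.ofReal_cos, -Complex.ofReal_sin]

lemma realCurve_im (ν x φ : ℝ) :
    (realCurve ν x φ).im = Real.exp (realCurveLog ν x φ) * Real.sin φ := by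
  rw [realCurve_eq, Complex.im_ofReal_mul]
  simp [-Complex.ofReal_cos, -Complex.ofReal_sin]

lemma realCurve_mem_upperSlit (h0 : 0 ≤ φ) (h1 : φ < Real.pi) :
    realCurve ν x φ ∈ upperSlit := by
  rw [upperSlit, mem_ofPred_eq, realCurve_re, realCurve_im]
  rcases h0.eq_or_lt with rfl | h
  · right; simp [Real.exp_pos]
  · left; have := Real.sin_pos_of_pos_of_lt_pi h h1; positivity

lemma realCurve_cpow (h0 : 0 ≤ φ) (h1 : φ < Real.pi) (p : ℂ) :
    realCurve ν x φ ^ p = Complex.exp ((realCurveLog ν x φ + φ * Complex.I) * p) := by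
  rw [realCurve, Complex.cpow_def_of_ne_zero (Complex.exp_ne_zero _), Complex.log_exp]
  · simp; linarith [Real.pi_pos]
  · simpa using h1.le

/-- This is Im s = x Im s^ν in polar coordinates; it rearranges ‖s‖^{1-ν} = x sin(νφ)/sin φ, the
equation that defines the curve. -/
lemma exp_mul_realCurveLog (hν : 0 < ν) (hν' : ν ≤ 1 / 2) (hx : 0 < x) (h0 : 0 < φ)
    (h1 : φ < Real.pi) : Real.exp (realCurveLog ν x φ) * Real.sin φ =
      x * (Real.exp (ν * realCurveLog ν x φ) * Real.sin (ν * φ)) := by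
  have hs := Real.sin_pos_of_pos_of_lt_pi h0 h1
  have h : Real.exp ((1 - ν) * realCurveLog ν x φ) = x * (Real.sin (ν * φ) / Real.sin φ) := by
    rw [realCurveLog, mul_div_cancel₀ _ (by linarith : 1 - ν ≠ 0),
      Real.exp_log (realCurve_quot_pos hν hν' hx h0.le h1), realCurve_quot_eq hν h0]
  have h2 : realCurveLog ν x φ = (1 - ν) * realCurveLog ν x φ + ν * realCurveLog ν x φ := by ring
  have h3 : Real.exp (realCurveLog ν x φ) =
      x * (Real.sin (ν * φ) / Real.sin φ) * Real.exp (ν * realCurveLog ν x φ) := by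
    rw [← h, ← Real.exp_add, ← h2]
  rw [h3]; field_simp

/-- The value of the exponent `s - x s ^ ν` on the curve. -/
noncomputable def realCurveExponent (ν x φ : ℝ) : ℝ :=
  Real.exp (realCurveLog ν x φ) * Real.cos φ -
    x * (Real.exp (ν * realCurveLog ν x φ) * Real.cos (ν * φ))

/-- Eliminating ‖s‖ with the equation of the curve leaves E sin φ = -x ‖s‖^ν sin((1 - ν)φ), and both
sines are positive. -/
lemma realCurveExponent_neg (hν : 0 < ν) (hν' : ν ≤ 1 / 2) (hx : 0 < x) (h0 : 0 < φ)
    (h1 : φ < Real.pi) : realCurveExponent ν x φ < 0 := by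
  have hs := Real.sin_pos_of_pos_of_lt_pi h0 h1
  have h : realCurveExponent ν x φ * Real.sin φ =
      -(x * Real.exp (ν * realCurveLog ν x φ) * Real.sin ((1 - ν) * φ)) := by
    rw [realCurveExponent, sub_mul, mul_right_comm, exp_mul_realCurveLog hν hν' hx h0 h1,
      show (1 - ν) * φ = φ - ν * φ by ring, Real.sin_sub]
    ring
  have hs2 : 0 < Real.sin ((1 - ν) * φ) :=
    Real.sin_pos_of_pos_of_lt_pi (by nlinarith) (by nlinarith)
  have : realCurveExponent ν x φ * Real.sin φ < 0 := by
    rw [h]; have := Real.exp_pos (ν * realCurveLog ν x φ)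
    exact neg_neg_of_pos (by positivity)
  by_contra hc
  push Not at hc
  nlinarith [mul_nonneg hc hs.le]

/-- The order μ = 1 is special: the kernel is e^{s - x s^ν} / s, and the factor s comes back from ds
= s (d log‖s‖ + i dφ). The imaginary part of the integrand is then e^E dφ. -/
lemma wrightKernel_realCurve (hν : 0 < ν) (hν' : ν ≤ 1 / 2) (hx : 0 < x) (h0 : 0 < φ)
    (h1 : φ < Real.pi) : realCurve ν x φ * wrightKernel 1 ν (-x) 1 (realCurve ν x φ) =
      (Real.exp (realCurveExponent ν x φ) : ℂ) := by
  have hne : realCurve ν x φ ≠ 0 := Complex.exp_ne_zero _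
  have e1 : realCurve ν x φ ^ (ν : ℂ) = Real.exp (ν * realCurveLog ν x φ) *
      (Real.cos (ν * φ) + Real.sin (ν * φ) * Complex.I) := by
    rw [realCurve_cpow h0.le h1, add_mul, Complex.exp_add,
      show (φ : ℂ) * Complex.I * ν = ((ν * φ : ℝ) : ℂ) * Complex.I by push_cast; ring,
      Complex.exp_mul_I]
    push_cast; ring_nf
  have key := exp_mul_realCurveLog hν hν' hx h0 h1
  rw [wrightKernel, Complex.ofReal_one, Complex.cpow_neg_one, mul_one]
  rw [show realCurve ν x φ * (Complex.exp (realCurve ν x φ) * (realCurve ν x φ)⁻¹ *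
    Complex.exp (((-x : ℝ) : ℂ) * realCurve ν x φ ^ (ν : ℂ))) = Complex.exp (realCurve ν x φ) *
    Complex.exp (((-x : ℝ) : ℂ) * realCurve ν x φ ^ (ν : ℂ)) by field_simp, ← Complex.exp_add,
    Complex.ofReal_exp]
  congr 1
  rw [e1]
  apply Complex.ext
  · rw [Complex.add_re, realCurve_re, Complex.re_ofReal_mul, Complex.re_ofReal_mul]
    simp [-Complex.ofReal_cos, -Complex.ofReal_sin, -Complex.ofReal_exp, realCurveExponent,
      sub_eq_add_neg]
  · rw [Complex.add_im, realCurve_im, Complex.im_ofReal_mul, Complex.im_ofReal_mul, key]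
    simp [-Complex.ofReal_cos, -Complex.ofReal_sin, -Complex.ofReal_exp]

lemma differentiableAt_realCurveLog (hν : 0 < ν) (hν' : ν ≤ 1 / 2) (hx : 0 < x) (h0 : 0 < φ)
    (h1 : φ < Real.pi) : DifferentiableAt ℝ (realCurveLog ν x) φ := by
  have hs := Real.sin_pos_of_pos_of_lt_pi h0 h1
  have hd : DifferentiableAt ℝ
      (fun φ => Real.log (x * (Real.sin (ν * φ) / Real.sin φ)) / (1 - ν)) φ := by
    have hpos := realCurve_quot_pos hν hν' hx h0.le h1
    rw [realCurve_quot_eq hν h0] at hpos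
    have h : DifferentiableAt ℝ (fun φ => x * (Real.sin (ν * φ) / Real.sin φ)) φ :=
      DifferentiableAt.const_mul (DifferentiableAt.div (by fun_prop) (by fun_prop) hs.ne') _
    exact (h.log hpos.ne').div_const _
  refine hd.congr_of_eventuallyEq ?_
  filter_upwards [Ioi_mem_nhds h0] with y hy
  rw [realCurveLog, realCurve_quot_eq hν hy]

lemma continuousAt_realCurveLog (hν : 0 < ν) (hν' : ν ≤ 1 / 2) (hx : 0 < x) (h0 : 0 ≤ φ)
    (h1 : φ < Real.pi) : ContinuousAt (realCurveLog ν x) φ := by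
  have hc := Real.continuous_sinc
  have h : ContinuousAt (fun φ => x * (ν * Real.sinc (ν * φ) / Real.sinc φ)) φ := by
    refine continuousAt_const.mul
      (ContinuousAt.div ?_ hc.continuousAt (sinc_pos_of_lt_pi h0 h1).ne')
    exact (continuous_const.mul (hc.comp (continuous_const.mul continuous_id))).continuousAt
  exact (h.log (realCurve_quot_pos hν hν' hx h0 h1).ne').div_const _

/-- The curve escapes to infinity as φ → π, since sin φ → 0 while sin(νπ) > 0. -/
lemma tendsto_exp_realCurveLog (hν : 0 < ν) (hν' : ν ≤ 1 / 2) (hx : 0 < x) :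
    Tendsto (fun φ => Real.exp (realCurveLog ν x φ)) (𝓝[<] Real.pi) atTop := by
  have hpi := Real.pi_pos
  have hev : ∀ᶠ φ in 𝓝[<] Real.pi, 0 < φ ∧ φ < Real.pi := by
    filter_upwards [Ioo_mem_nhdsLT hpi] with φ hφ using hφ
  have hsin : Tendsto (fun φ => (Real.sin φ)⁻¹) (𝓝[<] Real.pi) atTop := by
    refine tendsto_inv_nhdsGT_zero.comp (tendsto_nhdsWithin_iff.mpr ⟨?_, ?_⟩)
    · have := Real.continuous_sin.tendsto Real.pi
      rw [Real.sin_pi] at this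
      exact this.mono_left nhdsWithin_le_nhds
    · filter_upwards [hev] with φ hφ using Real.sin_pos_of_pos_of_lt_pi hφ.1 hφ.2
  have hnum : Tendsto (fun φ => x * Real.sin (ν * φ)) (𝓝[<] Real.pi)
      (𝓝 (x * Real.sin (ν * Real.pi))) :=
    ((by fun_prop : Continuous fun φ => x * Real.sin (ν * φ)).tendsto _).mono_left
      nhdsWithin_le_nhds
  have hpos : 0 < x * Real.sin (ν * Real.pi) :=
    mul_pos hx (Real.sin_pos_of_pos_of_lt_pi (by positivity) (by nlinarith))
  have h := Real.tendsto_exp_atTop.comp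
    ((Real.tendsto_log_atTop.comp (hnum.pos_mul_atTop hpos hsin)).atTop_div_const
    (by linarith : 0 < 1 - ν))
  refine h.congr' ?_
  filter_upwards [hev] with φ hφ
  simp only [Function.comp_apply, realCurveLog, realCurve_quot_eq hν hφ.1]
  congr 3
  field_simp

end

/-- The derivative of F is real on the positive axis. Needed because the curve does not start at 1
as the Hankel ray does. -/
lemma primitive_im_eq_of_pos {f F : ℂ → ℂ}
    (hF : ∀ s ∈ upperSlit, HasDerivWithinAt F (f s) upperSlit s)
    (hf : ∀ x : ℝ, 0 < x → (f x).im = 0) {x : ℝ} (hx : 0 < x) : (F x).im = (F 1).im := by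
  have hmaps : MapsTo (fun y : ℝ => (y : ℂ)) (Ioi 0) upperSlit := fun y hy => by
    right; simpa using hy
  have hd : ∀ y ∈ Ioi (0 : ℝ), HasDerivWithinAt (fun y : ℝ => (F y).im) 0 (Ioi 0) y := by
    intro y hy
    have := hasDerivWithinAt_comp_curve hF
      (Complex.ofRealCLM.hasDerivAt (x := y)).hasDerivWithinAt hmaps hy
    have := Complex.imCLM.hasFDerivAt.comp_hasDerivWithinAt y this
    simpa [Function.comp_def, hf y hy] using this
  have := (convex_Ioi (0 : ℝ)).norm_image_sub_le_of_norm_hasDerivWithin_le (C := 0) hd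
    (by simp) (mem_Ioi.mpr one_pos) (mem_Ioi.mpr hx)
  simp only [zero_mul, norm_le_zero_iff, sub_eq_zero, Complex.ofReal_one] at this
  exact this

section
variable {ν x : ℝ} {F : ℂ → ℂ}

lemma hasDerivAt_primitive_realCurve (hν : 0 < ν) (hν' : ν ≤ 1 / 2) (hx : 0 < x)
    (hF : ∀ s ∈ upperSlit, HasDerivWithinAt F (wrightKernel 1 ν (-x) 1 s) upperSlit s) {φ : ℝ}
    (h0 : 0 < φ) (h1 : φ < Real.pi) :
    HasDerivAt (fun φ => (F (realCurve ν x φ)).im) (Real.exp (realCurveExponent ν x φ)) φ := by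
  have hl := (differentiableAt_realCurveLog hν hν' hx h0 h1).hasDerivAt
  have hs : HasDerivAt (realCurve ν x)
      (realCurve ν x φ * ((deriv (realCurveLog ν x) φ : ℝ) + Complex.I)) φ := by
    have h2 : HasDerivAt (fun φ : ℝ => (φ : ℂ) * Complex.I) Complex.I φ := by
      simpa using (Complex.ofRealCLM.hasDerivAt (x := φ)).mul_const Complex.I
    exact (hl.ofReal_comp.add h2).cexp
  have := hasDerivWithinAt_comp_curve hF hs.hasDerivWithinAt
    (fun y hy => realCurve_mem_upperSlit (le_of_lt hy.1) hy.2) (S := Ioo 0 Real.pi) ⟨h0, h1⟩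
  have := Complex.imCLM.hasFDerivAt.comp_hasDerivAt φ (this.hasDerivAt (Ioo_mem_nhds h0 h1))
  refine HasDerivAt.congr_deriv this ?_
  rw [mul_right_comm, wrightKernel_realCurve hν hν' hx h0 h1, Complex.imCLM_apply,
    Complex.im_ofReal_mul]
  simp

lemma continuousOn_primitive_realCurve (hν : 0 < ν) (hν' : ν ≤ 1 / 2) (hx : 0 < x)
    (hF : ∀ s ∈ upperSlit, HasDerivWithinAt F (wrightKernel 1 ν (-x) 1 s) upperSlit s) :
    ContinuousOn (fun φ => (F (realCurve ν x φ)).im) (Ico 0 Real.pi) := by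
  refine Complex.continuous_im.comp_continuousOn ?_
  refine ContinuousOn.comp (t := upperSlit) (fun s hs => (hF s hs).continuousWithinAt) ?_
    fun φ hφ => realCurve_mem_upperSlit hφ.1 hφ.2
  intro φ hφ
  refine ContinuousAt.continuousWithinAt ?_
  have h := continuousAt_realCurveLog hν hν' hx hφ.1 hφ.2
  exact ((Complex.continuous_ofReal.continuousAt.comp h).add (by fun_prop)).cexp

/-- The end of the curve is compared with the point of the Hankel ray having the same real part -X.
The vertical segment between them has length at most 1 + X and the kernel is at most e^{-X} on it,
so the primitives have the same limit. -/
lemma tendsto_primitive_realCurve (hν : 0 < ν) (hν' : ν ≤ 1 / 2) (hx : 0 < x)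
    (hF : ∀ s ∈ upperSlit, HasDerivWithinAt F (wrightKernel 1 ν (-x) 1 s) upperSlit s) :
    Tendsto (fun φ => (F (realCurve ν x φ)).im) (𝓝[<] Real.pi)
      (𝓝 ((F 1).im + Real.pi * hankelIntegral 1 ν (-x) 1)) := by
  have hray := tendsto_primitive_ray hF (fun _ hρ => hankelRay_mem_upperSlit hρ)
    (integrableOn_wrightKernel_hankelRay (by linarith) 1 (-x) one_pos)
  have hray' : Tendsto (fun R : ℝ => (F (hankelRay R)).im) atTop
      (𝓝 ((F 1).im + Real.pi * hankelIntegral 1 ν (-x) 1)) := by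
    have := (Complex.continuous_im.tendsto _).comp hray
    rw [hankelIntegral, one_div, mul_inv_cancel_left₀ Real.pi_ne_zero, ← Complex.add_im]
    exact this
  set X : ℝ → ℝ := fun φ => -(realCurve ν x φ).re with hX
  have hcos : Tendsto (fun φ => -Real.cos φ) (𝓝[<] Real.pi) (𝓝 1) := by
    have := ((by fun_prop : Continuous fun φ => -Real.cos φ).tendsto Real.pi).mono_left
      (nhdsWithin_le_nhds (s := Iio Real.pi))
    simpa using this
  have hsin : Tendsto (fun φ => Real.sin φ) (𝓝[<] Real.pi) (𝓝 0) := by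
    have := (Real.continuous_sin.tendsto Real.pi).mono_left
      (nhdsWithin_le_nhds (s := Iio Real.pi))
    simpa using this
  have hXlim : Tendsto X (𝓝[<] Real.pi) atTop := by
    have := (tendsto_exp_realCurveLog hν hν' hx).atTop_mul_pos one_pos hcos
    refine this.congr fun φ => ?_
    simp [hX, realCurve_re]
  have hdiff : Tendsto (fun φ => F (realCurve ν x φ) - F (hankelRay (1 + X φ)))
      (𝓝[<] Real.pi) (𝓝 0) := by
    have hb : Tendsto (fun y : ℝ => Real.exp (-y) * (1 + y)) atTop (𝓝 0) := by
      have h1 := Real.tendsto_exp_neg_atTop_nhds_zero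
      have h2 := Real.tendsto_pow_mul_exp_neg_atTop_nhds_zero 1
      have := h1.add h2
      simp only [add_zero] at this
      refine this.congr fun y => by ring
    refine squeeze_zero_norm' ?_ (hb.comp hXlim)
    filter_upwards [hXlim.eventually_ge_atTop 1, Ioo_mem_nhdsLT Real.pi_pos,
      hsin.eventually_lt hcos one_pos] with φ hφ1 hφ hsc
    have hre : (realCurve ν x φ).re = -X φ := by simp [hX]
    have him0 : 0 < (realCurve ν x φ).im := by
      rw [realCurve_im]; exact mul_pos (Real.exp_pos _) (Real.sin_pos_of_pos_of_lt_pi hφ.1 hφ.2)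
    have him1 : (realCurve ν x φ).im ≤ X φ := by
      simp only [hX]
      rw [realCurve_im, realCurve_re, ← mul_neg]
      exact mul_le_mul_of_nonneg_left hsc.le (Real.exp_pos _).le
    have hmemC := realCurve_mem_upperSlit (ν := ν) (x := x) hφ.1.le hφ.2
    have hmemR : hankelRay (1 + X φ) ∈ upperSlit := hankelRay_mem_upperSlit (by linarith)
    have hsub := convex_upperSlit.segment_subset hmemR hmemC
    have hval : ∀ s ∈ segment ℝ (hankelRay (1 + X φ)) (realCurve ν x φ),
        ‖wrightKernel 1 ν (-x) 1 s‖ ≤ Real.exp (-X φ) := by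
      intro s hs
      have hs' := hsub hs
      have hsre : s.re = -X φ := by
        obtain ⟨u, v, hu, hv, huv, rfl⟩ := hs
        simp only [Complex.add_re, Complex.real_smul, Complex.re_ofReal_mul, hre, hankelRay_re]
        linear_combination (-X φ) * huv
      have hsim : 0 ≤ s.im := by rcases hs' with h | h <;> linarith [h]
      have hnorm : 1 ≤ ‖s‖ := by
        have := Complex.abs_re_le_norm s
        rw [hsre, abs_neg, abs_of_nonneg (by linarith)] at this
        linarith
      have harg0 := Complex.arg_nonneg_iff.mpr hsim
      have harg1 := Complex.arg_le_pi s
      -- The argument may come close to π here, beyond the sector used before; ν ≤ 1/2 still gives a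
      -- nonnegative cosine.
      have hc : 0 ≤ Real.cos (s.arg * ν) := Real.cos_nonneg_of_mem_Icc
        ⟨by nlinarith [Real.pi_pos], by nlinarith⟩
      have hc' : 0 ≤ ‖s‖ ^ ν := by positivity
      rw [norm_wrightKernel, hsre, mul_one, mul_assoc]
      refine mul_le_of_le_one_right (Real.exp_pos _).le (mul_le_one₀ ?_ (Real.exp_pos _).le ?_)
      · rw [Real.rpow_neg_one]; exact inv_le_one_of_one_le₀ hnorm
      · rw [Real.exp_le_one_iff]; nlinarith [mul_nonneg hc' hc, mul_nonneg hx.le (mul_nonneg hc' hc)]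
    refine ((convex_segment _ _).norm_image_sub_le_of_norm_hasDerivWithin_le
      (fun s hs => (hF s (hsub hs)).mono hsub) hval (left_mem_segment ℝ _ _)
      (right_mem_segment ℝ _ _)).trans ?_
    simp only [Function.comp_apply]
    gcongr
    refine (Complex.norm_le_abs_re_add_abs_im _).trans ?_
    rw [Complex.sub_re, Complex.sub_im, hankelRay_re, hankelRay_im, hre,
      show -X φ - (1 - (1 + X φ)) = 0 by ring, abs_zero, zero_add, abs_le]
    constructor <;> linarith
  have h1 := (Complex.continuous_im.tendsto _).comp hdiff
  have h2 := hray'.comp (tendsto_atTop_add_const_left _ (1 : ℝ) hXlim)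
  have := h1.add h2
  simp only [Complex.zero_im, zero_add] at this
  refine this.congr fun φ => ?_
  simp

/-- The Wright function `W(-x; -ν, 1)` takes values in `(0, 1)` for `x > 0`. -/
lemma wrightW_neg_mem_Ioo (hν : 0 < ν) (hν' : ν ≤ 1 / 2) (hx : 0 < x) :
    wrightW (-x) (-ν) 1 ∈ Ioo 0 1 := by
  rw [wrightW_eq_hankelIntegral (by linarith)]
  obtain ⟨F, hF⟩ := exists_primitive_upperSlit (differentiableOn_wrightKernel 1 ν (-x) 1)
  have hpi := Real.pi_pos
  set h : ℝ → ℝ := fun φ => (F (realCurve ν x φ)).im with hh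
  have hcont := continuousOn_primitive_realCurve hν hν' hx hF
  have hlim := tendsto_primitive_realCurve hν hν' hx hF
  have hder : ∀ φ ∈ interior (Ico 0 Real.pi),
      HasDerivAt h (Real.exp (realCurveExponent ν x φ)) φ := fun φ hφ => by
    rw [interior_Ico] at hφ
    exact hasDerivAt_primitive_realCurve hν hν' hx hF hφ.1 hφ.2
  -- As 0 < h' = e^E < 1, both h and φ - h increase strictly. The total increase of h on [0, π) is
  -- πW, which therefore lies between 0 and π.
  have hmono : StrictMonoOn h (Ico 0 Real.pi) :=
    strictMonoOn_of_deriv_pos (convex_Ico 0 Real.pi) hcont fun φ hφ => by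
      rw [(hder φ hφ).deriv]; exact Real.exp_pos _
  have hanti : StrictAntiOn (fun φ => h φ - φ) (Ico 0 Real.pi) :=
    strictAntiOn_of_deriv_neg (convex_Ico 0 Real.pi) (hcont.sub continuousOn_id) fun φ hφ => by
      have hd : HasDerivAt (fun φ => h φ - φ) _ φ := (hder φ hφ).sub (hasDerivAt_id φ)
      rw [hd.deriv, sub_neg, Real.exp_lt_one_iff]
      rw [interior_Ico] at hφ
      exact realCurveExponent_neg hν hν' hx hφ.1 hφ.2
  have h0 : h 0 = (F 1).im := by
    have := primitive_im_eq_of_pos hF (fun y hy => wrightKernel_im_of_pos 1 ν (-x) 1 hy)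
      (Real.exp_pos (realCurveLog ν x 0))
    rw [← this]; simp [hh, realCurve]
  have hmem0 : (0 : ℝ) ∈ Ico 0 Real.pi := ⟨le_rfl, hpi⟩
  -- An interior point keeps the inequalities strict when φ → π.
  have hmem1 : (1 : ℝ) ∈ Ico 0 Real.pi := ⟨zero_le_one, by linarith [Real.pi_gt_three]⟩
  have hev : ∀ᶠ φ in 𝓝[<] Real.pi, 1 < φ ∧ φ < Real.pi :=
    Ioo_mem_nhdsLT (by linarith [Real.pi_gt_three])
  have hid : Tendsto (fun φ : ℝ => φ) (𝓝[<] Real.pi) (𝓝 Real.pi) :=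
    tendsto_id.mono_left nhdsWithin_le_nhds
  have g1 : h 1 ≤ (F 1).im + Real.pi * hankelIntegral 1 ν (-x) 1 := by
    refine ge_of_tendsto hlim ?_
    filter_upwards [hev] with φ hφ
    exact (hmono hmem1 ⟨by linarith, hφ.2⟩ hφ.1).le
  have g2 : (F 1).im + Real.pi * hankelIntegral 1 ν (-x) 1 - Real.pi ≤ h 1 - 1 := by
    refine le_of_tendsto (hlim.sub hid) ?_
    filter_upwards [hev] with φ hφ
    exact (hanti hmem1 ⟨by linarith, hφ.2⟩ hφ.1).le
  have g3 := hmono hmem0 hmem1 one_pos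
  have g4 := hanti hmem0 hmem1 one_pos
  simp only [sub_zero] at g4
  rw [h0] at g3 g4
  constructor
  · by_contra hc; push Not at hc; nlinarith
  · by_contra hc; push Not at hc; nlinarith

end

/-! ### Time derivative and convolution rule -/

/-- Differentiating e^{st} brings down s, and e^{-a s^ν} keeps the integral convergent. The formula
holds for every real t; with the vanishing for t ≤ 0 it also gives the limit 0 at t = 0+. -/
lemma hasDerivAt_auxR_time {ν : ℝ} (hν : 0 < ν) (hν' : ν ≤ 1 / 2) (μ : ℝ) {a : ℝ} (ha : 0 < a)
    (t : ℝ) : HasDerivAt (auxR μ ν a) (auxR (μ - 1) ν a t) t := by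
  have hfun : auxR μ ν a = fun t => 1 / (2 * Real.pi) *
      (∫ y : ℝ, wrightKernel μ ν (-a) t (1 + y * Complex.I)).re :=
    funext (auxR_eq_integral μ ν ha)
  rw [hfun, auxR_eq_integral (μ - 1) ν ha]
  obtain ⟨C, hC0, hC⟩ := exists_norm_wrightKernel_line_le hν hν' (μ - 1) ha
  have h := (hasDerivAt_integral_of_dominated_loc_of_deriv_le
    (F := fun (t : ℝ) (y : ℝ) => wrightKernel μ ν (-a) t (1 + y * Complex.I))
    (F' := fun (t : ℝ) (y : ℝ) => wrightKernel (μ - 1) ν (-a) t (1 + y * Complex.I))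
    (x₀ := t) (bound := fun y => Real.exp (t + 1) * C * (1 + y ^ 2)⁻¹)
    (Metric.ball_mem_nhds t one_pos)
    (Eventually.of_forall fun t => (continuous_wrightKernel_line μ ν (-a) t).aestronglyMeasurable)
    (integrable_wrightKernel_line hν hν' μ ha t)
    (continuous_wrightKernel_line _ _ _ _).aestronglyMeasurable ?_
    (integrable_inv_one_add_sq.const_mul _) ?_).2
  · exact (Complex.reCLM.hasFDerivAt.comp_hasDerivAt t h).const_mul (1 / (2 * Real.pi))
  · refine Eventually.of_forall fun y s hs => (hC a s y le_rfl).trans ?_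
    have h1 : |s - t| < 1 := by simpa [Real.dist_eq] using hs
    have h2 := abs_lt.mp h1
    simp only [sub_self, neg_zero, zero_mul, Real.exp_zero, mul_one]
    rw [mul_assoc, ← div_eq_mul_inv]
    gcongr
    linarith
  · refine Eventually.of_forall fun y s _ => ?_
    have hne := Complex.slitPlane_ne_zero (one_add_mul_I_mem_slitPlane y)
    have h1 : HasDerivAt (fun s : ℝ => (1 + y * Complex.I : ℂ) * s) (1 + y * Complex.I) s := by
      simpa using (Complex.ofRealCLM.hasDerivAt (x := s)).const_mul (1 + y * Complex.I : ℂ)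
    have h2 := (h1.cexp.mul_const ((1 + y * Complex.I : ℂ) ^ (-(μ : ℂ)))).mul_const
      (Complex.exp (((-a : ℝ) : ℂ) * (1 + y * Complex.I) ^ (ν : ℂ)))
    refine h2.congr_deriv ?_
    have e : (1 + y * Complex.I : ℂ) ^ (-((μ - 1 : ℝ) : ℂ)) =
        (1 + y * Complex.I) ^ (-(μ : ℂ)) * (1 + y * Complex.I) := by
      nth_rewrite 3 [← Complex.cpow_one (1 + y * Complex.I : ℂ)]
      rw [← Complex.cpow_add _ _ hne]; congr 1; push_cast; ring
    rw [wrightKernel, e]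
    ring

lemma continuous_auxR_time {ν : ℝ} (hν : 0 < ν) (hν' : ν ≤ 1 / 2) (μ : ℝ) {a : ℝ} (ha : 0 < a) :
    Continuous (auxR μ ν a) :=
  continuous_iff_continuousAt.mpr fun t => (hasDerivAt_auxR_time hν hν' μ ha t).continuousAt

lemma contDiff_one_auxR_time {ν : ℝ} (hν : 0 < ν) (hν' : ν ≤ 1 / 2) (μ : ℝ) {a : ℝ} (ha : 0 < a) :
    ContDiff ℝ 1 (auxR μ ν a) := by
  refine contDiff_one_iff_deriv.mpr
    ⟨fun t => (hasDerivAt_auxR_time hν hν' μ ha t).differentiableAt, ?_⟩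
  rw [funext fun t => (hasDerivAt_auxR_time hν hν' μ ha t).deriv]
  exact continuous_auxR_time hν hν' _ ha

lemma tendsto_auxR_time_zero {ν : ℝ} (hν : 0 < ν) (hν' : ν ≤ 1 / 2) (μ : ℝ) {a : ℝ} (ha : 0 < a) :
    Tendsto (auxR μ ν a) (𝓝[>] 0) (𝓝 0) := by
  have := (continuous_auxR_time hν hν' μ ha).tendsto 0
  rw [auxR_of_nonpos hν hν' μ ha le_rfl] at this
  exact this.mono_left nhdsWithin_le_nhds

lemma intervalIntegrable_sub_rpow {β : ℝ} (hβ : 0 < β) (t : ℝ) :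
    IntervalIntegrable (fun τ : ℝ => (t - τ) ^ (β - 1)) volume 0 t := by
  have := (intervalIntegral.intervalIntegrable_rpow' (a := 0) (b := t)
    (by linarith : -1 < β - 1)).comp_sub_left t
  simpa using this.symm

lemma intervalIntegrable_sub_rpow_mul_auxR {ν : ℝ} (hν : 0 < ν) (hν' : ν ≤ 1 / 2) (μ : ℝ)
    {a β : ℝ} (ha : 0 < a) (hβ : 0 < β) (t : ℝ) :
    IntervalIntegrable (fun τ : ℝ => (t - τ) ^ (β - 1) * auxR μ ν a τ) volume 0 t :=
  (intervalIntegrable_sub_rpow hβ t).mul_continuousOn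
    (continuous_auxR_time hν hν' μ ha).continuousOn

/-- By Fubini the σ-integration acts on e^{-sσ} and produces Γ(β) s^{-β}. Integrating over the whole
half-line is harmless, because R vanishes at negative times. -/
lemma integral_Ioi_rpow_mul_auxR {ν : ℝ} (hν : 0 < ν) (hν' : ν ≤ 1 / 2) (μ : ℝ) {a β : ℝ}
    (ha : 0 < a) (hβ : 0 < β) (t : ℝ) :
    ∫ σ : ℝ in Ioi 0, σ ^ (β - 1) * auxR μ ν a (t - σ) =
      Real.Gamma β * auxR (μ + β) ν a t := by
  set l : ℝ → ℂ := fun y => 1 + y * Complex.I with hl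
  set k : ℝ → ℂ := fun y => wrightKernel μ ν (-a) t (l y) with hk
  have hsplit : ∀ σ y : ℝ, wrightKernel μ ν (-a) (t - σ) (l y) =
      Complex.exp (-l y * σ) * k y := fun σ y => by
    simp only [hk, wrightKernel]
    rw [Complex.ofReal_sub, mul_sub, sub_eq_neg_add, Complex.exp_add]
    ring_nf
  have hlre : ∀ y, (l y).re = 1 := fun y => by simp [hl]
  have hint : Integrable (Function.uncurry fun σ y : ℝ =>
      ((σ ^ (β - 1) : ℝ) : ℂ) * Complex.exp (-l y * σ) * k y)
      ((volume.restrict (Ioi 0)).prod volume) := by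
    have h1 := integrableOn_rpow_mul_exp_neg_mul (b := 1) (p := β - 1) (by linarith) one_pos
    have h2 : Integrable fun y => ‖k y‖ := (integrable_wrightKernel_line hν hν' μ ha t).norm
    refine (h1.mul_prod h2).mono' ?_ ?_
    · refine Measurable.aestronglyMeasurable ?_
      have hkm : Measurable k := (continuous_wrightKernel_line μ ν (-a) t).measurable
      have hlm : Measurable l := (by fun_prop : Continuous l).measurable
      simp only [Function.uncurry_def]
      fun_prop
    · have hfst : ∀ᵐ p : ℝ × ℝ ∂((volume.restrict (Ioi 0)).prod volume), p.1 ∈ Ioi (0 : ℝ) :=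
        Measure.quasiMeasurePreserving_fst.ae (ae_restrict_mem measurableSet_Ioi)
      filter_upwards [hfst] with p hp
      rw [Function.uncurry_apply_pair, norm_mul, norm_rpow_mul_cexp hp, hlre]
  have hswap := integral_integral_swap hint
  have hR : ∀ y : ℝ, ∫ σ : ℝ in Ioi 0, ((σ ^ (β - 1) : ℝ) : ℂ) * Complex.exp (-l y * σ) * k y =
      Real.Gamma β * wrightKernel (μ + β) ν (-a) t (l y) := fun y => by
    rw [integral_mul_const, integral_rpow_mul_cexp_neg hβ (by rw [hlre]; exact one_pos)]
    simp only [hk, wrightKernel]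
    have e : l y ^ (-((μ + β : ℝ) : ℂ)) = l y ^ (-(μ : ℂ)) * l y ^ (-(β : ℂ)) := by
      rw [← Complex.cpow_add _ _ (Complex.slitPlane_ne_zero (one_add_mul_I_mem_slitPlane y))]
      congr 1; push_cast; ring
    rw [e]; ring
  have hL : ∀ σ : ℝ, ∫ y : ℝ, ((σ ^ (β - 1) : ℝ) : ℂ) * Complex.exp (-l y * σ) * k y =
      ((σ ^ (β - 1) : ℝ) : ℂ) * ∫ y : ℝ, wrightKernel μ ν (-a) (t - σ) (l y) := fun σ => by
    rw [← integral_const_mul]; congr 1; ext y; rw [hsplit, mul_assoc]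
  have hintL := hint.integral_prod_left
  simp only [Function.uncurry_apply_pair, hL] at hintL
  simp only [hR, hL] at hswap
  rw [integral_const_mul] at hswap
  have hre := congrArg Complex.re hswap
  rw [Complex.re_ofReal_mul, ← RCLike.re_eq_complex_re, ← integral_re hintL] at hre
  simp only [RCLike.re_eq_complex_re, Complex.re_ofReal_mul] at hre
  rw [auxR_eq_integral (μ + β) ν ha]
  simp only [auxR_eq_integral μ ν ha]
  have e : ∀ σ : ℝ, σ ^ (β - 1) * (1 / (2 * Real.pi) *
      (∫ y : ℝ, wrightKernel μ ν (-a) (t - σ) (1 + y * Complex.I)).re) = 1 / (2 * Real.pi) *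
      (σ ^ (β - 1) * (∫ y : ℝ, wrightKernel μ ν (-a) (t - σ) (l y)).re) := fun σ => by
    simp only [hl]; ring
  simp only [e]
  rw [integral_const_mul, hre]
  ring

/-- The convolution rule `δ_β * R_{μ,ν}(a, ·) = R_{μ + β,ν}(a, ·)`. -/
lemma integral_sub_rpow_mul_auxR {ν : ℝ} (hν : 0 < ν) (hν' : ν ≤ 1 / 2) (μ : ℝ) {a β t : ℝ}
    (ha : 0 < a) (hβ : 0 < β) (ht : 0 ≤ t) :
    ∫ τ in (0 : ℝ)..t, (t - τ) ^ (β - 1) * auxR μ ν a τ =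
      Real.Gamma β * auxR (μ + β) ν a t := by
  rw [← integral_Ioi_rpow_mul_auxR hν hν' μ ha hβ t]
  have h := intervalIntegral.integral_comp_sub_left
    (fun σ => σ ^ (β - 1) * auxR μ ν a (t - σ)) (a := 0) (b := t) t
  simp only [sub_sub_cancel, sub_self, sub_zero] at h
  rw [h, intervalIntegral.integral_of_le ht]
  refine (setIntegral_eq_of_subset_of_forall_sdiff_eq_zero measurableSet_Ioi Ioc_subset_Ioi_self
    fun σ hσ => ?_).symm
  have hσt : t < σ := by
    by_contra hc
    exact hσ.2 ⟨hσ.1, not_lt.mp hc⟩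
  rw [auxR_of_nonpos hν hν' μ ha (by linarith), mul_zero]

/-! ### Fractional integrals of powers and of R -/

/-- The Beta integral on `(0, t)`. -/
lemma integral_sub_rpow_mul_rpow {a b t : ℝ} (ha : 0 < a) (hb : 0 < b) (ht : 0 < t) :
    ∫ τ in (0 : ℝ)..t, (t - τ) ^ (a - 1) * τ ^ (b - 1) =
      Real.Gamma a * Real.Gamma b / Real.Gamma (a + b) * t ^ (a + b - 1) := by
  have h := Complex.betaIntegral_scaled (b : ℂ) (a : ℂ) ht
  have h2 := Complex.Gamma_mul_Gamma_eq_betaIntegral (s := (b : ℂ)) (t := (a : ℂ))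
    (by simpa using hb) (by simpa using ha)
  have hG : Complex.Gamma ((b : ℂ) + a) ≠ 0 := by
    rw [← Complex.ofReal_add, Complex.Gamma_ofReal]
    exact_mod_cast (Real.Gamma_pos_of_pos (by linarith)).ne'
  have hB : Complex.betaIntegral b a =
      ((Real.Gamma a * Real.Gamma b / Real.Gamma (a + b) : ℝ) : ℂ) := by
    rw [← Complex.ofReal_add, Complex.Gamma_ofReal] at h2 hG
    rw [Complex.Gamma_ofReal, Complex.Gamma_ofReal] at h2
    push_cast
    rw [add_comm a b, eq_div_iff hG, mul_comm, ← h2, mul_comm]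
  have hl : (∫ x in (0 : ℝ)..t, (x : ℂ) ^ ((b : ℂ) - 1) * ((t : ℂ) - x) ^ ((a : ℂ) - 1)) =
      ((∫ τ in (0 : ℝ)..t, (t - τ) ^ (a - 1) * τ ^ (b - 1) : ℝ) : ℂ) := by
    rw [← intervalIntegral.integral_ofReal]
    refine intervalIntegral.integral_congr fun x hx => ?_
    rw [uIcc_of_le ht.le] at hx
    rw [Complex.ofReal_mul, Complex.ofReal_cpow hx.1, Complex.ofReal_cpow (sub_nonneg.mpr hx.2)]
    push_cast; ring
  rw [hl, hB, show (b : ℂ) + a - 1 = ((a + b - 1 : ℝ) : ℂ) by push_cast; ring,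
    ← Complex.ofReal_cpow ht.le, ← Complex.ofReal_mul] at h
  rw [Complex.ofReal_inj.mp h, mul_comm]

/-- Without integrability the integral would be 0 by convention, whereas the Beta value is positive.
-/
lemma intervalIntegrable_sub_rpow_mul_rpow {a b t : ℝ} (ha : 0 < a) (hb : 0 < b) (ht : 0 < t) :
    IntervalIntegrable (fun τ : ℝ => (t - τ) ^ (a - 1) * τ ^ (b - 1)) volume 0 t := by
  by_contra hc
  have h := integral_sub_rpow_mul_rpow ha hb ht
  rw [intervalIntegral.integral_undef hc] at h
  have := Real.Gamma_pos_of_pos ha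
  have := Real.Gamma_pos_of_pos hb
  have := Real.Gamma_pos_of_pos (add_pos ha hb)
  have : 0 < Real.Gamma a * Real.Gamma b / Real.Gamma (a + b) * t ^ (a + b - 1) := by positivity
  linarith

lemma natCeil_two_mul {ν : ℝ} (hν : 0 < ν) (hν' : ν ≤ 1 / 2) : ⌈2 * ν⌉₊ = 1 := by
  rw [Nat.ceil_eq_iff one_ne_zero]
  constructor
  · simpa using hν
  · push_cast; linarith

/-- The Caputo derivative of order `2ν ≤ 1` in terms of the first derivative. -/
lemma hasCaputoDeriv_two_mul_iff {ν : ℝ} (hν : 0 < ν) (hν' : ν ≤ 1 / 2) (y : ℝ → ℝ) (t d : ℝ) :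
    HasCaputoDeriv (2 * ν) y t d ↔ ContDiffOn ℝ 1 y (Ioi 0) ∧
      RLIntegrable (1 - 2 * ν) (deriv y) t ∧ rlIntegral (1 - 2 * ν) (deriv y) t = d := by
  rw [HasCaputoDeriv, natCeil_two_mul hν hν', iteratedDeriv_one]
  norm_num

/-- The fractional integral of order `β` of `R_{μ,ν}(a, ·)` is `R_{μ + β,ν}(a, ·)`. -/
lemma rlIntegral_auxR {ν : ℝ} (hν : 0 < ν) (hν' : ν ≤ 1 / 2) (μ : ℝ) {a β t : ℝ}
    (ha : 0 < a) (hβ : 0 ≤ β) (ht : 0 ≤ t) (c : ℝ) :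
    RLIntegrable β (fun τ => c * auxR μ ν a τ) t ∧
      rlIntegral β (fun τ => c * auxR μ ν a τ) t = c * auxR (μ + β) ν a t := by
  rcases hβ.eq_or_lt with rfl | hβ
  · simp [RLIntegrable, rlIntegral]
  have e : ∀ τ : ℝ, (t - τ) ^ (β - 1) * (c * auxR μ ν a τ) =
      c * ((t - τ) ^ (β - 1) * auxR μ ν a τ) := fun τ => by ring
  constructor
  · right
    simp only [e]
    exact (intervalIntegrable_sub_rpow_mul_auxR hν hν' μ ha hβ t).const_mul c
  · rw [rlIntegral, if_neg hβ.ne']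
    simp only [e]
    rw [intervalIntegral.integral_const_mul, integral_sub_rpow_mul_auxR hν hν' μ ha hβ ht]
    have := (Real.Gamma_pos_of_pos hβ).ne'
    field_simp

/-! ### The Caputo problem -/

/-- The spatial profile at time `t`, an entire function of `x` which is `R_{μ,ν}(x,t)` for
`x ≥ 0`. -/
noncomputable def wrightProfile (μ ν t x : ℝ) : ℝ :=
  t ^ (μ - 1) * wrightW (-x * t ^ (-ν)) (-ν) μ

section
variable {ν : ℝ}

lemma hasDerivAt_wrightProfile (hν : ν < 1) (μ : ℝ) {t : ℝ} (ht : 0 < t) (x : ℝ) :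
    HasDerivAt (wrightProfile μ ν t) (-wrightProfile (μ - ν) ν t x) x := by
  have h1 : HasDerivAt (fun x : ℝ => -x * t ^ (-ν)) (-t ^ (-ν)) x := by
    simpa using (hasDerivAt_id x).neg.mul_const (t ^ (-ν))
  have h2 := ((hasDerivAt_wrightW hν μ (-x * t ^ (-ν))).comp x h1).const_mul (t ^ (μ - 1))
  refine HasDerivAt.congr_deriv h2 ?_
  rw [wrightProfile, show μ - ν - 1 = (μ - 1) + -ν by ring, Real.rpow_add ht]
  ring

lemma continuous_wrightProfile (hν : ν < 1) (μ : ℝ) {t : ℝ} (ht : 0 < t) :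
    Continuous (wrightProfile μ ν t) :=
  continuous_iff_continuousAt.mpr fun x => (hasDerivAt_wrightProfile hν μ ht x).continuousAt

lemma deriv_wrightProfile (hν : ν < 1) (μ : ℝ) {t : ℝ} (ht : 0 < t) :
    deriv (wrightProfile μ ν t) = fun x => -wrightProfile (μ - ν) ν t x :=
  funext fun x => (hasDerivAt_wrightProfile hν μ ht x).deriv

lemma contDiff_two_wrightProfile (hν : ν < 1) (μ : ℝ) {t : ℝ} (ht : 0 < t) :
    ContDiff ℝ 2 (wrightProfile μ ν t) := by
  have h1 : ∀ μ, ContDiff ℝ 1 (wrightProfile μ ν t) := fun μ => by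
    refine contDiff_one_iff_deriv.mpr
      ⟨fun x => (hasDerivAt_wrightProfile hν μ ht x).differentiableAt, ?_⟩
    rw [deriv_wrightProfile hν μ ht]
    exact (continuous_wrightProfile hν _ ht).neg
  rw [show (2 : WithTop ℕ∞) = 1 + 1 by norm_num, contDiff_succ_iff_deriv]
  refine ⟨fun x => (hasDerivAt_wrightProfile hν μ ht x).differentiableAt, by simp, ?_⟩
  rw [deriv_wrightProfile hν μ ht]
  exact (h1 _).neg

lemma auxR_eq_wrightProfile (hν : 0 < ν) (hν' : ν ≤ 1 / 2) (μ : ℝ) {x t : ℝ} (hx : 0 ≤ x)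
    (ht : 0 < t) : auxR μ ν x t = wrightProfile μ ν t x :=
  auxR_eq_rpow_mul_wrightW hν hν' μ hx ht

/-- The similarity variable x t^{-ν} is the constant 2α on the boundary, so only the power of t
survives. -/
lemma wrightProfile_similarityEta (μ α : ℝ) {t : ℝ} (ht : 0 < t) :
    wrightProfile μ ν t (similarityEta ν α t) = t ^ (μ - 1) * wrightW (-2 * α) (-ν) μ := by
  rw [wrightProfile, similarityEta]
  have : t ^ ν * t ^ (-ν) = 1 := by rw [← Real.rpow_add ht]; simp
  congr 2
  linear_combination (-2 * α) * this

lemma similarityEta_pos {α t : ℝ} (hα : 0 < α) (ht : 0 < t) : 0 < similarityEta ν α t := by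
  rw [similarityEta]; positivity

lemma one_sub_wrightW_pos (hν : 0 < ν) (hν' : ν ≤ 1 / 2) {α : ℝ} (hα : 0 < α) :
    0 < 1 - wrightW (-2 * α) (-ν) 1 := by
  have := (wrightW_neg_mem_Ioo hν hν' (x := 2 * α) (by positivity)).2
  rw [← neg_mul] at this
  linarith

lemma hasCaputoDeriv_similarityEta (hν : 0 < ν) (hν' : ν ≤ 1 / 2) (α : ℝ) {t : ℝ} (ht : 0 < t) :
    HasCaputoDeriv (2 * ν) (similarityEta ν α) t
      (2 * α * Real.Gamma (1 + ν) / Real.Gamma (1 - ν) * t ^ (-ν)) := by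
  have hd : ∀ τ : ℝ, 0 < τ → deriv (similarityEta ν α) τ = 2 * α * ν * τ ^ (ν - 1) := by
    intro τ hτ
    have := (Real.hasDerivAt_rpow_const (p := ν) (Or.inl hτ.ne')).const_mul (2 * α)
    rw [← mul_assoc] at this
    exact this.deriv
  rw [hasCaputoDeriv_two_mul_iff hν hν']
  refine ⟨?_, ?_⟩
  · intro τ hτ
    exact (contDiffAt_const.mul (Real.contDiffAt_rpow_const_of_ne
      (ne_of_gt hτ))).contDiffWithinAt
  have hG1 : Real.Gamma (1 + ν) = ν * Real.Gamma ν := by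
    rw [add_comm, Real.Gamma_add_one hν.ne']
  -- For ν = 1/2 the order 1 - 2ν is 0 and the fractional integral is the identity; otherwise the
  -- Beta integral applies.
  rcases hν'.eq_or_lt with h | h
  · refine ⟨Or.inl (by linarith), ?_⟩
    rw [rlIntegral, if_pos (by linarith), hd t ht, hG1, show 1 - ν = ν by linarith,
      show ν - 1 = -ν by linarith]
    have := (Real.Gamma_pos_of_pos hν).ne'
    field_simp
  have hβ : 0 < 1 - 2 * ν := by linarith
  have e : EqOn (fun τ : ℝ => 2 * α * ν * ((t - τ) ^ (1 - 2 * ν - 1) * τ ^ (ν - 1)))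
      (fun τ : ℝ => (t - τ) ^ (1 - 2 * ν - 1) * deriv (similarityEta ν α) τ) (uIoc 0 t) := by
    intro τ hτ
    rw [uIoc_of_le ht.le] at hτ
    simp only [hd τ hτ.1]
    ring
  refine ⟨Or.inr ?_, ?_⟩
  · exact ((intervalIntegrable_sub_rpow_mul_rpow hβ hν ht).const_mul (2 * α * ν)).congr e
  · rw [rlIntegral, if_neg hβ.ne', ← intervalIntegral.integral_congr_ae (Eventually.of_forall fun τ hτ => e hτ),
      intervalIntegral.integral_const_mul, integral_sub_rpow_mul_rpow hβ hν ht, hG1,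
      show 1 - 2 * ν + ν = 1 - ν by ring, show 1 - ν - 1 = -ν by ring]
    have := (Real.Gamma_pos_of_pos hβ).ne'
    field_simp

lemma similarityU_eq (hν : 0 < ν) (hν' : ν ≤ 1 / 2) (α : ℝ) {x t : ℝ} (hx : 0 ≤ x) (ht : 0 < t) :
    similarityU ν α x t = (wrightProfile 1 ν t x - wrightW (-2 * α) (-ν) 1) /
      (1 - wrightW (-2 * α) (-ν) 1) := by
  rw [similarityU, auxR_eq_wrightProfile hν hν' 1 hx ht]

lemma similarityU_eventuallyEq (hν : 0 < ν) (hν' : ν ≤ 1 / 2) (α : ℝ) {x t : ℝ} (hx : 0 < x)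
    (ht : 0 < t) : (fun ξ => similarityU ν α ξ t) =ᶠ[𝓝 x]
      fun ξ => (wrightProfile 1 ν t ξ - wrightW (-2 * α) (-ν) 1) /
        (1 - wrightW (-2 * α) (-ν) 1) := by
  filter_upwards [Ioi_mem_nhds hx] with ξ hξ
  exact similarityU_eq hν hν' α (le_of_lt hξ) ht

lemma hasDerivAt_similarityU (hν : 0 < ν) (hν' : ν ≤ 1 / 2) (α : ℝ) {x t : ℝ} (hx : 0 < x)
    (ht : 0 < t) : HasDerivAt (fun ξ => similarityU ν α ξ t)
      (-wrightProfile (1 - ν) ν t x / (1 - wrightW (-2 * α) (-ν) 1)) x :=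
  (((hasDerivAt_wrightProfile (by linarith) 1 ht x).sub_const _).div_const
    _).congr_of_eventuallyEq (similarityU_eventuallyEq hν hν' α hx ht)

lemma iteratedDeriv_two_similarityU (hν : 0 < ν) (hν' : ν ≤ 1 / 2) (α : ℝ) {x t : ℝ} (hx : 0 < x)
    (ht : 0 < t) : iteratedDeriv 2 (fun ξ => similarityU ν α ξ t) x =
      auxR (1 - 2 * ν) ν x t / (1 - wrightW (-2 * α) (-ν) 1) := by
  rw [auxR_eq_wrightProfile hν hν' _ hx.le ht, iteratedDeriv_succ, iteratedDeriv_one]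
  have h1 : deriv (fun ξ => similarityU ν α ξ t) =ᶠ[𝓝 x]
      fun ξ => -wrightProfile (1 - ν) ν t ξ / (1 - wrightW (-2 * α) (-ν) 1) := by
    filter_upwards [Ioi_mem_nhds hx] with ξ hξ
    exact (hasDerivAt_similarityU hν hν' α hξ ht).deriv
  have h2 : HasDerivAt (fun ξ => -wrightProfile (1 - ν) ν t ξ / (1 - wrightW (-2 * α) (-ν) 1)) _ x :=
    (hasDerivAt_wrightProfile (by linarith) (1 - ν) ht x).neg.div_const _
  rw [h1.deriv_eq, h2.deriv, neg_neg, show 1 - ν - ν = 1 - 2 * ν by ring]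

/-- ∂_t R_1 = R_0, and the integral of order 1 - 2ν raises this to R_{1-2ν}, the same function as
the second space derivative. -/
lemma hasCaputoDeriv_similarityU (hν : 0 < ν) (hν' : ν ≤ 1 / 2) (α : ℝ) {x t : ℝ} (hx : 0 < x)
    (ht : 0 < t) : HasCaputoDeriv (2 * ν) (fun τ => similarityU ν α x τ) t
      (auxR (1 - 2 * ν) ν x t / (1 - wrightW (-2 * α) (-ν) 1)) := by
  rw [hasCaputoDeriv_two_mul_iff hν hν']
  have hd : deriv (fun τ => similarityU ν α x τ) =
      fun τ => (1 - wrightW (-2 * α) (-ν) 1)⁻¹ * auxR 0 ν x τ := by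
    ext τ
    have := ((hasDerivAt_auxR_time hν hν' 1 hx τ).sub_const
      (wrightW (-2 * α) (-ν) 1)).div_const (1 - wrightW (-2 * α) (-ν) 1)
    refine this.deriv.trans ?_
    rw [sub_self, div_eq_inv_mul]
  refine ⟨?_, ?_⟩
  · exact ContDiff.contDiffOn
      (((contDiff_one_auxR_time hν hν' 1 hx).sub contDiff_const).div_const _)
  · rw [hd]
    have := rlIntegral_auxR hν hν' 0 hx (by linarith : 0 ≤ 1 - 2 * ν) ht.le
      (1 - wrightW (-2 * α) (-ν) 1)⁻¹
    refine ⟨this.1, this.2.trans ?_⟩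
    rw [zero_add, div_eq_inv_mul]

lemma tendsto_similarityU_time_zero (hν : 0 < ν) (hν' : ν ≤ 1 / 2) (α : ℝ) {x : ℝ} (hx : 0 < x) :
    Tendsto (fun t => similarityU ν α x t) (𝓝[>] 0)
      (𝓝 (-wrightW (-2 * α) (-ν) 1 / (1 - wrightW (-2 * α) (-ν) 1))) := by
  have := ((tendsto_auxR_time_zero hν hν' 1 hx).sub_const
    (wrightW (-2 * α) (-ν) 1)).div_const (1 - wrightW (-2 * α) (-ν) 1)
  rwa [zero_sub] at this

/-- The Stefan condition has the factor t^{-ν} on both sides, so its validity at one time is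
equivalent to its validity at all times. -/
lemma transcendentalEq_iff (hν : 0 < ν) (hν' : ν ≤ 1 / 2) {r α t : ℝ} (hr : 0 < r) (hα : 0 < α)
    (ht : 0 < t) :
    TranscendentalEq ν r α ↔ 2 * α * Real.Gamma (1 + ν) / Real.Gamma (1 - ν) * t ^ (-ν) =
      -(1 / r) * (-wrightProfile (1 - ν) ν t (similarityEta ν α t) /
        (1 - wrightW (-2 * α) (-ν) 1)) := by
  have h1 := (one_sub_wrightW_pos hν hν' hα).ne'
  have h2 := (Real.Gamma_pos_of_pos (by linarith : 0 < 1 - ν)).ne'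
  have h3 : t ^ (-ν) ≠ 0 := by positivity
  rw [TranscendentalEq, wrightProfile_similarityEta _ _ ht, show 1 - ν - 1 = -ν by ring]
  set w := wrightW (-2 * α) (-ν) 1
  set m := wrightW (-2 * α) (-ν) (1 - ν)
  set G := 2 * α * Real.Gamma (1 + ν) / Real.Gamma (1 - ν) with hG
  have e1 : 2 * α * r * Real.Gamma (1 + ν) / Real.Gamma (1 - ν) = G * r := by rw [hG]; ring
  have e2 : -(1 / r) * (-(t ^ (-ν) * m) / (1 - w)) = m / (r * (1 - w)) * t ^ (-ν) := by
    field_simp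
  rw [e1, e2, mul_left_inj' h3, eq_div_iff (by positivity), mul_assoc]

lemma isCaputoStefanSolution_similarity_iff (hν : 0 < ν) (hν' : ν ≤ 1 / 2) {r α : ℝ} (u₀ : ℝ)
    (hr : 0 < r) (hα : 0 < α) :
    IsCaputoStefanSolution ν r u₀ (similarityU ν α) (similarityEta ν α) ↔
      (u₀ = -wrightW (-2 * α) (-ν) 1 / (1 - wrightW (-2 * α) (-ν) 1) ∧
        TranscendentalEq ν r α) := by
  have hw := (one_sub_wrightW_pos hν hν' hα).ne'
  have hq : ∀ t > 0, HasDerivWithinAt (fun x => similarityU ν α x t)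
      (-wrightProfile (1 - ν) ν t (similarityEta ν α t) / (1 - wrightW (-2 * α) (-ν) 1))
      (Iic (similarityEta ν α t)) (similarityEta ν α t) := fun t ht =>
    (hasDerivAt_similarityU hν hν' α (similarityEta_pos hα ht) ht).hasDerivWithinAt
  constructor
  · intro h
    refine ⟨tendsto_nhds_unique (h.initial 1 one_pos)
      (tendsto_similarityU_time_zero hν hν' α one_pos), ?_⟩
    -- The time t = 1 suffices; uniqueness of the one-sided derivative identifies the flux q.
    obtain ⟨q, hq', hD⟩ := h.stefan 1 one_pos
    have hqe := (uniqueDiffWithinAt_Iic _).eq_deriv _ hq' (hq 1 one_pos)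
    have h1 := ((hasCaputoDeriv_two_mul_iff hν hν' _ _ _).mp hD).2.2
    have h2 := ((hasCaputoDeriv_two_mul_iff hν hν' _ _ _).mp
      (hasCaputoDeriv_similarityEta hν hν' α one_pos)).2.2
    rw [transcendentalEq_iff hν hν' hr hα one_pos, ← hqe, ← h1, ← h2]
  · rintro ⟨rfl, hT⟩
    refine ⟨fun t ht => similarityEta_pos hα ht, fun t ht x hx _ => ⟨?_, ?_⟩,
      fun x hx => tendsto_similarityU_time_zero hν hν' α hx, fun t ht => ?_, fun t ht => ?_,
      fun t ht => ?_, fun t ht => ⟨_, hq t ht, ?_⟩⟩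
    · exact ContDiffAt.congr_of_eventuallyEq
        (((contDiff_two_wrightProfile (by linarith) 1 ht).sub contDiff_const).div_const
          _).contDiffAt (similarityU_eventuallyEq hν hν' α hx ht)
    · rw [iteratedDeriv_two_similarityU hν hν' α hx ht]
      exact hasCaputoDeriv_similarityU hν hν' α hx ht
    · have : auxR 1 ν 0 t = 1 := by simp [auxR, fracDelta]
      rw [similarityU, this, div_self hw]
    · have hc : Continuous fun ξ => (wrightProfile 1 ν t ξ - wrightW (-2 * α) (-ν) 1) /
          (1 - wrightW (-2 * α) (-ν) 1) :=
        ((continuous_wrightProfile (by linarith) 1 ht).sub continuous_const).div_const _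
      exact hc.continuousWithinAt.congr (fun x hx => similarityU_eq hν hν' α hx ht)
        (similarityU_eq hν hν' α le_rfl ht)
    · rw [similarityU_eq hν hν' α (similarityEta_pos hα ht).le ht,
        wrightProfile_similarityEta _ _ ht]
      simp
    · rw [← (transcendentalEq_iff hν hν' hr hα ht).mp hT]
      exact hasCaputoDeriv_similarityEta hν hν' α ht

/-- Intermediate value theorem for the difference of the two sides. At α = 0 it is -1/Γ(1 - ν) < 0.
For large α both Wright functions are small: once 1 - W ≥ 1/2 and cα ≥ 2, the left side is at least
1 and the right side at most 1. -/
lemma exists_transcendentalEq (hν : 0 < ν) (hν' : ν ≤ 1 / 2) {r : ℝ} (hr : 0 < r) :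
    ∃ α, 0 < α ∧ TranscendentalEq ν r α := by
  set c := 2 * r * Real.Gamma (1 + ν) / Real.Gamma (1 - ν) with hc
  have hΓ := Real.Gamma_pos_of_pos (by linarith : 0 < 1 - ν)
  have hc0 : 0 < c := by
    have := Real.Gamma_pos_of_pos (by linarith : 0 < 1 + ν)
    positivity
  set f : ℝ → ℝ := fun α => c * α * (1 - wrightW (-2 * α) (-ν) 1) -
    wrightW (-2 * α) (-ν) (1 - ν) with hf
  have hW : ∀ μ, Continuous fun α : ℝ => wrightW (-2 * α) (-ν) μ := fun μ =>
    (continuous_wrightW (by linarith) μ).comp (by fun_prop)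
  have hfc : Continuous f := by
    have := hW 1; have := hW (1 - ν); fun_prop
  have hlim : ∀ μ, Tendsto (fun α : ℝ => wrightW (-2 * α) (-ν) μ) atTop (𝓝 0) := fun μ => by
    have := (tendsto_wrightW_atTop hν hν' μ).comp
      (tendsto_id.const_mul_atTop (two_pos : (0 : ℝ) < 2))
    simpa [Function.comp_def, neg_mul] using this
  obtain ⟨A, hA1, hA2, hA3, hA4⟩ := (((hlim 1).eventually_le_const
    (by norm_num : (0 : ℝ) < 1 / 2)).and (((hlim (1 - ν)).eventually_le_const one_pos).and
    ((eventually_ge_atTop (2 / c)).and (eventually_ge_atTop 0)))).exists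
  have hcA : 2 ≤ c * A := by
    rw [div_le_iff₀ hc0] at hA3; linarith
  have hfA : 0 ≤ f A := by
    simp only [hf]; nlinarith
  have hf0 : f 0 < 0 := by
    simp [hf, wrightW_zero, hΓ]
  obtain ⟨α, hα, hα0⟩ := intermediate_value_Icc hA4 hfc.continuousOn ⟨hf0.le, hfA⟩
  refine ⟨α, lt_of_le_of_ne hα.1 ?_, ?_⟩
  · rintro rfl; linarith
  · rw [TranscendentalEq]
    have : 2 * α * r * Real.Gamma (1 + ν) / Real.Gamma (1 - ν) = c * α := by rw [hc]; ring
    rw [this]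
    simp only [hf] at hα0
    linarith

end

/-! ### The classical case ν = 1/2 -/

/-- The derivative is W(z; -1/2, 0), and integration by parts at μ = 0 expresses this as -(z/2) W(z;
-1/2, 1/2). The resulting linear equation makes W e^{z²/4} constant. -/
lemma wrightW_neg_half_half (z : ℝ) :
    wrightW z (-(1 / 2)) (1 / 2) = Real.exp (-z ^ 2 / 4) / √Real.pi := by
  have hW : ∀ z, HasDerivAt (fun z => wrightW z (-(1 / 2)) (1 / 2))
      (-(z / 2) * wrightW z (-(1 / 2)) (1 / 2)) z := fun z => by
    refine (hasDerivAt_wrightW (by norm_num : (1 / 2 : ℝ) < 1) (1 / 2) z).congr_deriv ?_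
    have := hankelIntegral_parts (by norm_num : (1 / 2 : ℝ) < 1) 0 z one_pos
    rw [show (0 : ℝ) + 1 - 1 / 2 = 1 / 2 by norm_num] at this
    rw [sub_self, wrightW_eq_hankelIntegral (by norm_num), wrightW_eq_hankelIntegral (by norm_num)]
    linear_combination this
  have hE : ∀ z : ℝ, HasDerivAt (fun z : ℝ => Real.exp (z ^ 2 / 4))
      (Real.exp (z ^ 2 / 4) * (z / 2)) z := fun z => by
    have := (((hasDerivAt_id z).pow 2).div_const 4).exp
    refine HasDerivAt.congr_deriv this ?_
    simp; ring
  have hconst := is_const_of_deriv_eq_zero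
    (f := fun z => wrightW z (-(1 / 2)) (1 / 2) * Real.exp (z ^ 2 / 4))
    (fun z => ((hW z).mul (hE z)).differentiableAt)
    (fun z => by
      have h : HasDerivAt (fun z => wrightW z (-(1 / 2)) (1 / 2) * Real.exp (z ^ 2 / 4)) _ z :=
        (hW z).mul (hE z)
      rw [h.deriv]; ring) z 0
  simp only [wrightW_zero, Real.Gamma_one_half_eq] at hconst
  have he : Real.exp (z ^ 2 / 4) * Real.exp (-z ^ 2 / 4) = 1 := by
    rw [← Real.exp_add, ← Real.exp_zero]; ring_nf
  norm_num at hconst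
  calc wrightW z (-(1 / 2)) (1 / 2)
      = (wrightW z (-(1 / 2)) (1 / 2) * Real.exp (z ^ 2 / 4)) * Real.exp (-z ^ 2 / 4) := by
        rw [mul_assoc, he, mul_one]
    _ = _ := by norm_num; rw [hconst]; ring

lemma hasDerivAt_errorFun (x : ℝ) :
    HasDerivAt errorFun (2 / √Real.pi * Real.exp (-x ^ 2)) x := by
  have hc : Continuous fun s : ℝ => Real.exp (-s ^ 2) := by fun_prop
  exact (intervalIntegral.integral_hasDerivAt_right (hc.intervalIntegrable _ _)
    hc.stronglyMeasurable.stronglyMeasurableAtFilter hc.continuousAt).const_mul _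

lemma wrightW_neg_half_one (x : ℝ) : wrightW (-2 * x) (-(1 / 2)) 1 = 1 - errorFun x := by
  have hd : ∀ x, HasDerivAt (fun x => wrightW (-2 * x) (-(1 / 2)) 1 + errorFun x) 0 x := fun x => by
    have h1 : HasDerivAt (fun x : ℝ => -2 * x) (-2) x := by
      simpa using (hasDerivAt_id x).const_mul (-2 : ℝ)
    have h2 := ((hasDerivAt_wrightW (by norm_num : (1 / 2 : ℝ) < 1) 1 (-2 * x)).comp x h1).add
      (hasDerivAt_errorFun x)
    refine HasDerivAt.congr_deriv h2 ?_
    rw [show (1 : ℝ) - 1 / 2 = 1 / 2 by norm_num, wrightW_neg_half_half,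
      show -(-2 * x) ^ 2 / 4 = -x ^ 2 by ring]
    ring
  have := is_const_of_deriv_eq_zero (fun x => (hd x).differentiableAt) (fun x => (hd x).deriv) x 0
  simp only [mul_zero, wrightW_zero, Real.Gamma_one, errorFun, intervalIntegral.integral_same] at this
  rw [errorFun]
  linarith

lemma similarityU_half {α x t : ℝ} (hα : 0 < α) (hx : 0 ≤ x) (ht : 0 < t) :
    similarityU (1 / 2) α x t = 1 - errorFun (x / (2 * √t)) / errorFun α := by
  have hw := (one_sub_wrightW_pos (by norm_num : (0 : ℝ) < 1 / 2) le_rfl hα).ne'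
  rw [similarityU_eq (by norm_num) le_rfl α hx ht, wrightProfile]
  -- This also turns `hw` into the statement that `errorFun α` is nonzero.
  rw [wrightW_neg_half_one, sub_sub_cancel] at *
  have : -x * t ^ (-(1 / 2) : ℝ) = -2 * (x / (2 * √t)) := by
    rw [Real.rpow_neg ht.le, ← Real.sqrt_eq_rpow]
    have := (Real.sqrt_pos.mpr ht).ne'
    field_simp
  rw [this, wrightW_neg_half_one, sub_self, Real.rpow_zero]
  field_simp
  ring

lemma transcendentalEq_half_iff {α r : ℝ} :
    TranscendentalEq (1 / 2) r α ↔ r * √Real.pi * α * errorFun α * Real.exp (α ^ 2) = 1 := by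
  have hpi : √Real.pi ≠ 0 := (Real.sqrt_pos.mpr Real.pi_pos).ne'
  have hG : Real.Gamma (1 + 1 / 2) = 1 / 2 * √Real.pi := by
    rw [add_comm, Real.Gamma_add_one (by norm_num), Real.Gamma_one_half_eq]
  rw [TranscendentalEq, hG, show (1 : ℝ) - 1 / 2 = 1 / 2 by norm_num, Real.Gamma_one_half_eq,
    wrightW_neg_half_one, wrightW_neg_half_half, show -(-2 * α) ^ 2 / 4 = -α ^ 2 by ring,
    Real.exp_neg]
  have he := (Real.exp_pos (α ^ 2)).ne'
  rw [sub_sub_cancel]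
  have e : 2 * α * r * (1 / 2 * √Real.pi) / √Real.pi * errorFun α = α * r * errorFun α := by
    field_simp
  rw [e, eq_div_iff hpi, inv_eq_one_div, eq_div_iff he]
  ring_nf

/-! ### The embedding representation -/

section
variable {ν : ℝ}

lemma auxR_zero_left (μ ν t : ℝ) : auxR μ ν 0 t = fracDelta μ t := by simp [auxR]

lemma integrableOn_wrightProfile (hν : 0 < ν) (hν' : ν ≤ 1 / 2) (μ : ℝ) {t : ℝ} (ht : 0 < t) :
    IntegrableOn (wrightProfile μ ν t) (Ioi 0) := by
  refine integrable_of_isBigO_exp_neg cos_three_pi_div_eight_pos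
    (continuous_wrightProfile (by linarith) μ ht).continuousOn ?_
  obtain ⟨C, hC0, hC⟩ := exists_abs_auxR_le hν hν' μ one_pos
  refine Asymptotics.IsBigO.of_bound (C * Real.exp t * Real.exp (Real.cos (3 * Real.pi / 8))) ?_
  filter_upwards [eventually_ge_atTop 1] with a ha
  rw [← auxR_eq_wrightProfile hν hν' μ (by linarith) ht, Real.norm_eq_abs, Real.norm_eq_abs,
    Real.abs_exp]
  refine (hC a t ha).trans (le_of_eq ?_)
  rw [mul_assoc (C * Real.exp t), ← Real.exp_add]
  ring_nf

/-- The mass of the fundamental solution on the half-line. -/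
lemma integral_Ioi_auxR (hν : 0 < ν) (hν' : ν ≤ 1 / 2) (μ : ℝ) {t : ℝ} (ht : 0 < t) :
    ∫ a in Ioi 0, auxR μ ν a t = fracDelta (μ + ν) t := by
  have h1 : ∫ a in Ioi 0, auxR μ ν a t = ∫ a in Ioi 0, wrightProfile μ ν t a :=
    setIntegral_congr_fun measurableSet_Ioi fun a ha =>
      auxR_eq_wrightProfile hν hν' μ (le_of_lt ha) ht
  have hlim : Tendsto (fun a => -wrightProfile (μ + ν) ν t a) atTop (𝓝 0) := by
    have := (tendsto_auxR_atTop hν hν' (μ + ν) t).neg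
    rw [neg_zero] at this
    refine this.congr' ?_
    filter_upwards [eventually_ge_atTop 0] with a ha
    rw [auxR_eq_wrightProfile hν hν' _ ha ht]
  have hd : ∀ a ∈ Ici (0 : ℝ), HasDerivAt (fun a => -wrightProfile (μ + ν) ν t a)
      (wrightProfile μ ν t a) a := fun a _ => by
    have := (hasDerivAt_wrightProfile (by linarith : ν < 1) (μ + ν) ht a).neg
    rwa [neg_neg, add_sub_cancel_right] at this
  rw [h1, integral_Ioi_of_hasDerivAt_of_tendsto' hd (integrableOn_wrightProfile hν hν' μ ht) hlim,
    ← auxR_eq_wrightProfile hν hν' _ le_rfl ht, auxR_zero_left]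
  ring

/-- The exceptional point ξ = 0 is a null set, and by translation invariance the rest is twice the
mass on the half-line, independently of x. -/
lemma integral_rlEmbedding_initial (hν : 0 < ν) (hν' : ν ≤ 1 / 2) (u₀ x : ℝ) {t : ℝ}
    (ht : 0 < t) :
    ∫ ξ : ℝ, 1 / 2 * auxR ν ν |x - ξ| t * (if ξ = 0 then 0 else u₀) =
      u₀ * fracDelta (2 * ν) t := by
  have h1 : ∫ ξ : ℝ, 1 / 2 * auxR ν ν |x - ξ| t * (if ξ = 0 then 0 else u₀) =
      ∫ ξ : ℝ, u₀ / 2 * auxR ν ν |x - ξ| t := by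
    refine integral_congr_ae ?_
    filter_upwards [compl_mem_ae_iff.mpr (measure_singleton (0 : ℝ))] with ξ hξ
    rw [if_neg (by simpa using hξ)]; ring
  rw [h1, integral_const_mul, integral_sub_left_eq_self (fun y => auxR ν ν |y| t) volume x,
    integral_comp_abs (f := fun a => auxR ν ν a t), integral_Ioi_auxR hν hν' ν ht,
    ← two_mul]
  ring

/-- Convolution with δ_{1-2ν} raises the order from 2ν to 1. At x = 0, where R is a power, this is
the Beta integral. -/
lemma integral_auxR_mul_fracDelta (hν : 0 < ν) (hν' : ν < 1 / 2) {x t : ℝ} (hx : 0 ≤ x)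
    (ht : 0 < t) : ∫ τ in (0 : ℝ)..t, 1 / 2 * auxR (2 * ν) ν x (t - τ) *
      (2 * fracDelta (1 - 2 * ν) τ) = auxR 1 ν x t := by
  have hβ : 0 < 1 - 2 * ν := by linarith
  have hG := Real.Gamma_pos_of_pos hβ
  have h := intervalIntegral.integral_comp_sub_left (fun τ => 1 / 2 * auxR (2 * ν) ν x τ *
      (2 * fracDelta (1 - 2 * ν) (t - τ))) (a := 0) (b := t) t
  simp only [sub_sub_cancel, sub_self, sub_zero] at h
  rw [h]
  rcases hx.eq_or_lt with rfl | hx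
  · have e : ∀ τ : ℝ, 1 / 2 * auxR (2 * ν) ν 0 τ * (2 * fracDelta (1 - 2 * ν) (t - τ)) =
        1 / (Real.Gamma (1 - 2 * ν) * Real.Gamma (2 * ν)) *
          ((t - τ) ^ (1 - 2 * ν - 1) * τ ^ (2 * ν - 1)) := fun τ => by
      rw [auxR_zero_left, fracDelta, fracDelta]; field_simp
    have hG2 := Real.Gamma_pos_of_pos (by linarith : 0 < 2 * ν)
    simp only [e]
    rw [intervalIntegral.integral_const_mul, integral_sub_rpow_mul_rpow hβ (by linarith) ht,
      auxR_zero_left, fracDelta]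
    simp
    field_simp
  · have e : ∀ τ : ℝ, 1 / 2 * auxR (2 * ν) ν x τ * (2 * fracDelta (1 - 2 * ν) (t - τ)) =
        1 / Real.Gamma (1 - 2 * ν) * ((t - τ) ^ (1 - 2 * ν - 1) * auxR (2 * ν) ν x τ) :=
      fun τ => by rw [fracDelta]; field_simp
    simp only [e]
    rw [intervalIntegral.integral_const_mul,
      integral_sub_rpow_mul_auxR hν hν'.le _ hx hβ ht.le,
      show 2 * ν + (1 - 2 * ν) = 1 by ring]
    field_simp

lemma rlEmbedding_fracDelta (hν : 0 < ν) (hν' : ν < 1 / 2) (u₀ : ℝ) {x t : ℝ} (hx : 0 ≤ x)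
    (ht : 0 < t) :
    rlEmbedding ν u₀ (fun τ => 2 * fracDelta (1 - 2 * ν) τ) (-2 * u₀) x t =
      u₀ * fracDelta (2 * ν) t + auxR 1 ν x t - u₀ * auxR (2 * ν) ν x t := by
  rw [rlEmbedding, integral_rlEmbedding_initial hν hν'.le u₀ x ht,
    integral_auxR_mul_fracDelta hν hν' hx ht]
  ring

lemma intervalIntegrable_fracDelta {μ : ℝ} (hμ : 0 < μ) (t : ℝ) :
    IntervalIntegrable (fracDelta μ) volume 0 t :=
  (intervalIntegral.intervalIntegrable_rpow' (by linarith)).div_const _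

end

/-! ### Abel's integral equation -/

/-- The kernel of the composition of two fractional integrals. -/
noncomputable def rlCompositionKernel (p q t τ σ : ℝ) : ℝ :=
  if σ < τ then (t - τ) ^ (q - 1) * (τ - σ) ^ (p - 1) else 0

section
variable {p q t : ℝ}

lemma measurable_rlCompositionKernel (p q t : ℝ) :
    Measurable (Function.uncurry (rlCompositionKernel p q t)) := by
  simp only [Function.uncurry_def, rlCompositionKernel]
  refine Measurable.ite (measurableSet_lt measurable_snd measurable_fst) ?_ measurable_const
  fun_prop

lemma integrable_rlCompositionKernel (hp : 0 < p) (hq : 0 < q) {σ : ℝ} (h0 : 0 < σ) (h1 : σ < t) :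
    Integrable (fun τ => rlCompositionKernel p q t τ σ) (volume.restrict (Ioc 0 t)) ∧
    ∫ τ in Ioc 0 t, rlCompositionKernel p q t τ σ =
      Real.Gamma q * Real.Gamma p / Real.Gamma (q + p) * (t - σ) ^ (q + p - 1) := by
  have e : (fun τ => rlCompositionKernel p q t τ σ) =
      (Ioi σ).indicator fun τ => (t - σ - (τ - σ)) ^ (q - 1) * (τ - σ) ^ (p - 1) := by
    ext τ
    simp only [rlCompositionKernel, indicator_apply, mem_Ioi, sub_sub_sub_cancel_right]
  have hset : Ioi σ ∩ Ioc 0 t = Ioc σ t := by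
    ext y; simp only [mem_inter_iff, mem_Ioi, mem_Ioc]
    constructor
    · rintro ⟨a, b, c⟩; exact ⟨a, c⟩
    · rintro ⟨a, c⟩; exact ⟨a, by linarith, c⟩
  rw [e, integrable_indicator_iff measurableSet_Ioi, integral_indicator measurableSet_Ioi,
    IntegrableOn, Measure.restrict_restrict measurableSet_Ioi, hset]
  constructor
  · have := (intervalIntegrable_sub_rpow_mul_rpow hq hp (sub_pos.mpr h1)).comp_sub_right σ
    rw [zero_add, sub_add_cancel] at this
    exact (intervalIntegrable_iff_integrableOn_Ioc_of_le h1.le).mp this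
  · rw [← intervalIntegral.integral_of_le h1.le, intervalIntegral.integral_comp_sub_right
      (fun y => (t - σ - y) ^ (q - 1) * y ^ (p - 1)), sub_self,
      integral_sub_rpow_mul_rpow hq hp (sub_pos.mpr h1)]

lemma rlCompositionKernel_nonneg {τ : ℝ} (hτ : τ ≤ t) (σ : ℝ) :
    0 ≤ rlCompositionKernel p q t τ σ := by
  rw [rlCompositionKernel]
  split_ifs with h
  · have := sub_nonneg.mpr hτ
    have := sub_pos.mpr h
    positivity
  · exact le_rfl

/-- The composition of fractional integrals of orders `p` and `q` with `p + q = 1`. -/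
lemma integral_sub_rpow_mul_integral_sub_rpow (hp : 0 < p) (hq : 0 < q) (hpq : q + p = 1)
    (ht : 0 < t) {φ : ℝ → ℝ} (hφ : IntervalIntegrable φ volume 0 t) :
    ∫ τ in (0 : ℝ)..t, (t - τ) ^ (q - 1) * ∫ σ in (0 : ℝ)..τ, (τ - σ) ^ (p - 1) * φ σ =
      Real.Gamma q * Real.Gamma p * ∫ τ in (0 : ℝ)..t, φ τ := by
  set B := Real.Gamma q * Real.Gamma p with hB
  set m := (volume.restrict (Ioc 0 t) : Measure ℝ) with hm
  have hφm : Integrable φ m := (intervalIntegrable_iff_integrableOn_Ioc_of_le ht.le).mp hφ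
  have hK := fun (σ : ℝ) (h0 : 0 < σ) (h1 : σ < t) =>
    integrable_rlCompositionKernel hp hq h0 h1
  simp only [hpq, sub_self, Real.rpow_zero, Real.Gamma_one, div_one, mul_one] at hK
  have hae : ∀ᵐ σ ∂m, 0 < σ ∧ σ < t := by
    have h2 : ∀ᵐ σ ∂m, σ ≠ t :=
      ae_restrict_of_ae (compl_mem_ae_iff.mpr (measure_singleton t))
    filter_upwards [ae_restrict_mem measurableSet_Ioc, h2] with σ hσ hne
    exact ⟨hσ.1, lt_of_le_of_ne hσ.2 hne⟩
  -- The kernel is nonnegative, and since p + q = 1 its τ-integral is the constant `B`;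
  -- integrability of φ is thus enough for Fubini.
  have hint : Integrable (Function.uncurry fun τ σ => rlCompositionKernel p q t τ σ * φ σ)
      (m.prod m) := by
    have hmeas : AEStronglyMeasurable
        (Function.uncurry fun τ σ => rlCompositionKernel p q t τ σ * φ σ) (m.prod m) :=
      (measurable_rlCompositionKernel p q t).aestronglyMeasurable.mul
        hφm.aestronglyMeasurable.comp_snd
    refine (integrable_prod_iff' hmeas).mpr ⟨?_, ?_⟩
    · filter_upwards [hae] with σ hσ
      exact (hK σ hσ.1 hσ.2).1.mul_const (φ σ)
    · refine (hφm.norm.const_mul B).congr ?_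
      filter_upwards [hae] with σ hσ
      have : ∀ τ ∈ Ioc 0 t, ‖rlCompositionKernel p q t τ σ * φ σ‖ =
          rlCompositionKernel p q t τ σ * ‖φ σ‖ := fun τ hτ => by
        rw [norm_mul, Real.norm_of_nonneg (rlCompositionKernel_nonneg hτ.2 σ)]
      simp only [Function.uncurry_apply_pair]
      rw [hm, setIntegral_congr_fun measurableSet_Ioc this, integral_mul_const,
        (hK σ hσ.1 hσ.2).2]
  have hswap := integral_integral_swap hint
  have hR : ∫ σ, ∫ τ, rlCompositionKernel p q t τ σ * φ σ ∂m ∂m = B * ∫ σ, φ σ ∂m := by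
    rw [← integral_const_mul]
    refine integral_congr_ae ?_
    filter_upwards [hae] with σ hσ
    rw [integral_mul_const, (hK σ hσ.1 hσ.2).2]
  have hL : ∀ τ ∈ Ioc 0 t, ∫ σ, rlCompositionKernel p q t τ σ * φ σ ∂m =
      (t - τ) ^ (q - 1) * ∫ σ in (0 : ℝ)..τ, (τ - σ) ^ (p - 1) * φ σ := fun τ hτ => by
    have e : (fun σ => rlCompositionKernel p q t τ σ * φ σ) = (Iio τ).indicator
        fun σ => (t - τ) ^ (q - 1) * ((τ - σ) ^ (p - 1) * φ σ) := by
      ext σ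
      simp only [rlCompositionKernel, indicator_apply, mem_Iio]
      split_ifs <;> ring
    have hset : Iio τ ∩ Ioc 0 t = Ioo 0 τ := by
      ext y; simp only [mem_inter_iff, mem_Iio, mem_Ioc, mem_Ioo]
      constructor
      · rintro ⟨a, b, c⟩; exact ⟨b, a⟩
      · rintro ⟨b, a⟩; exact ⟨a, b, a.le.trans hτ.2⟩
    rw [e, integral_indicator measurableSet_Iio, hm, Measure.restrict_restrict measurableSet_Iio,
      hset, integral_const_mul, ← integral_Ioc_eq_integral_Ioo,
      ← intervalIntegral.integral_of_le hτ.1.le]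
  rw [intervalIntegral.integral_of_le ht.le, intervalIntegral.integral_of_le ht.le, ← hR,
    ← hswap]
  exact (setIntegral_congr_fun measurableSet_Ioc hL).symm

/-- Uniqueness of the solution of Abel's integral equation, with an unknown point mass. -/
lemma abel_uniqueness (hp : 0 < p) (hq : 0 < q) (hpq : q + p = 1) {φ : ℝ → ℝ} {k : ℝ}
    (hφ : ∀ t > 0, IntervalIntegrable φ volume 0 t)
    (h : ∀ t > 0, ∫ σ in (0 : ℝ)..t, (t - σ) ^ (p - 1) * φ σ =
      2 * Real.Gamma p - k * t ^ (p - 1)) :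
    k = 0 ∧ ∀ᵐ t, 0 < t → φ t = 2 * fracDelta q t := by
  have hGp := Real.Gamma_pos_of_pos hp
  have hGq := Real.Gamma_pos_of_pos hq
  have hGq1 : Real.Gamma (q + 1) = q * Real.Gamma q := Real.Gamma_add_one hq.ne'
  -- The fractional integral of order q turns the left side of the equation into a multiple of the
  -- primitive of φ, and the term k t^{p-1} into a constant.
  have hprim : ∀ t > 0, ∫ τ in (0 : ℝ)..t, φ τ = 2 * t ^ q / Real.Gamma (q + 1) - k := by
    intro t ht
    have h1 := integral_sub_rpow_mul_integral_sub_rpow hp hq hpq ht (hφ t ht)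
    have i1 := intervalIntegrable_sub_rpow_mul_rpow hq one_pos ht
    have i2 := intervalIntegrable_sub_rpow_mul_rpow hq hp ht
    have h2 : ∫ τ in (0 : ℝ)..t, (t - τ) ^ (q - 1) * ∫ σ in (0 : ℝ)..τ, (τ - σ) ^ (p - 1) * φ σ =
        ∫ τ in (0 : ℝ)..t, (2 * Real.Gamma p * ((t - τ) ^ (q - 1) * τ ^ ((1 : ℝ) - 1)) -
          k * ((t - τ) ^ (q - 1) * τ ^ (p - 1))) := by
      refine intervalIntegral.integral_congr_ae (Eventually.of_forall fun τ hτ => ?_)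
      rw [uIoc_of_le ht.le] at hτ
      rw [h τ hτ.1, sub_self, Real.rpow_zero]
      ring
    rw [h2, intervalIntegral.integral_sub (i1.const_mul _) (i2.const_mul _),
      intervalIntegral.integral_const_mul, intervalIntegral.integral_const_mul,
      integral_sub_rpow_mul_rpow hq one_pos ht, integral_sub_rpow_mul_rpow hq hp ht, hpq,
      sub_self, Real.rpow_zero, Real.Gamma_one, add_sub_cancel_right] at h1
    have hB : Real.Gamma q * Real.Gamma p ≠ 0 := by positivity
    refine mul_left_cancel₀ hB ?_
    rw [← h1, hGq1]
    field_simp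
  -- The primitive of an integrable function tends to 0 at 0+, while the formula tends to -k.
  have hk : k = 0 := by
    have hc : ContinuousWithinAt (fun t => ∫ τ in (0 : ℝ)..t, φ τ) (Icc 0 1) 0 :=
      intervalIntegral.continuousOn_primitive_interval
        ((intervalIntegrable_iff_integrableOn_Icc_of_le zero_le_one).mp (hφ 1 one_pos) |>.mono_set
          (by rw [uIcc_of_le zero_le_one])) |>.mono (by rw [uIcc_of_le zero_le_one]) |>.continuousWithinAt
        ⟨le_rfl, zero_le_one⟩
    have h1 : Tendsto (fun t => ∫ τ in (0 : ℝ)..t, φ τ) (𝓝[>] 0) (𝓝 0) := by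
      have := hc.tendsto
      rw [intervalIntegral.integral_same] at this
      exact this.mono_left (nhdsWithin_le_of_mem (Icc_mem_nhdsGT one_pos))
    have h2 : Tendsto (fun t : ℝ => 2 * t ^ q / Real.Gamma (q + 1) - k) (𝓝[>] 0) (𝓝 (0 - k)) := by
      have := (Real.continuousAt_rpow_const 0 q (Or.inr hq.le)).tendsto
      rw [Real.zero_rpow hq.ne'] at this
      have := (((this.const_mul 2).div_const (Real.Gamma (q + 1))).sub_const k).mono_left
        (nhdsWithin_le_nhds (s := Ioi 0))
      simpa using this
    have h3 := tendsto_nhds_unique_of_eventuallyEq h1 h2 (by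
      filter_upwards [self_mem_nhdsWithin] with t ht using hprim t ht)
    linarith
  refine ⟨hk, ?_⟩
  -- Lebesgue differentiation recovers φ almost everywhere from its primitive, on each interval of a
  -- countable exhaustion.
  have hn : ∀ n : ℕ, ∀ᵐ x : ℝ, x ∈ Ioo (0 : ℝ) (n + 1) → φ x = 2 * fracDelta q x := fun n => by
    filter_upwards [(hφ (n + 1) (by positivity)).ae_hasDerivAt_integral] with x hx hx0
    have hd := hx (by rw [uIcc_of_le (by positivity)]; exact Ioo_subset_Icc_self hx0) 0
      (by simp)
    have hd2 : HasDerivAt (fun x : ℝ => 2 * x ^ q / Real.Gamma (q + 1) - k)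
        (2 * (q * x ^ (q - 1)) / Real.Gamma (q + 1)) x :=
      (((Real.hasDerivAt_rpow_const (Or.inl hx0.1.ne')).const_mul 2).div_const _).sub_const _
    have := (hd2.congr_of_eventuallyEq (by
      filter_upwards [Ioi_mem_nhds hx0.1] with t ht using hprim t ht)).unique hd
    rw [← this, fracDelta, hGq1]
    field_simp
  filter_upwards [ae_all_iff.mpr hn] with x hx hx0
  obtain ⟨n, hn⟩ := exists_nat_ge x
  exact hx n ⟨hx0, by linarith⟩

end

/-! ### Nonexistence in the Riemann–Liouville case -/

section
variable {ν : ℝ}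

/-- The source term of an embedding is determined by the boundary condition at `x = 0`. -/
lemma rlEmbedding_eq_of_left_value (hν : 0 < ν) (hν' : ν < 1 / 2) {u₀ c : ℝ} {φ : ℝ → ℝ}
    (hφ : ∀ t > 0, IntervalIntegrable φ volume 0 t)
    (h : ∀ t > 0, rlEmbedding ν u₀ φ c 0 t = 1) {x t : ℝ} (hx : 0 ≤ x) (ht : 0 < t) :
    rlEmbedding ν u₀ φ c x t =
      u₀ * fracDelta (2 * ν) t + auxR 1 ν x t - u₀ * auxR (2 * ν) ν x t := by
  have hG := (Real.Gamma_pos_of_pos (by linarith : 0 < 2 * ν))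
  -- At x = 0 both R_{2ν,ν} and the initial term are multiples of t^{2ν-1}; the point mass of the
  -- Abel equation is k = 2u₀ + c.
  have habel : ∀ t > 0, ∫ σ in (0 : ℝ)..t, (t - σ) ^ (2 * ν - 1) * φ σ =
      2 * Real.Gamma (2 * ν) - (2 * u₀ + c) * t ^ (2 * ν - 1) := fun t ht => by
    have h1 := h t ht
    rw [rlEmbedding, integral_rlEmbedding_initial hν hν'.le u₀ 0 ht] at h1
    have e : ∀ τ : ℝ, 1 / 2 * auxR (2 * ν) ν 0 (t - τ) * φ τ =
        1 / (2 * Real.Gamma (2 * ν)) * ((t - τ) ^ (2 * ν - 1) * φ τ) := fun τ => by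
      rw [auxR_zero_left, fracDelta]; field_simp
    simp only [e] at h1
    rw [intervalIntegral.integral_const_mul, auxR_zero_left, fracDelta] at h1
    field_simp at h1
    linear_combination h1
  obtain ⟨hc, hae⟩ := abel_uniqueness (by linarith) (by linarith : 0 < 1 - 2 * ν)
    (by ring) hφ habel
  rw [← rlEmbedding_fracDelta hν hν' u₀ hx ht, rlEmbedding, rlEmbedding,
    show c = -2 * u₀ by linarith]
  congr 2
  refine intervalIntegral.integral_congr_ae ?_
  filter_upwards [hae] with τ hτ hτ0
  rw [uIoc_of_le ht.le] at hτ0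
  rw [hτ hτ0.1]

/-- On the similarity curve the determined u is W + K t^{2ν-1}. Since 2^{2ν-1} ≠ 1, zeros at t = 1
and t = 2 would force W = 0, against W > 0. -/
lemma rlEmbedding_not_boundary_values (hν : 0 < ν) (hν' : ν < 1 / 2) {u₀ c α : ℝ} {φ : ℝ → ℝ}
    (hφ : ∀ t > 0, IntervalIntegrable φ volume 0 t) (hα : 0 < α) :
    ¬ ((∀ t > 0, rlEmbedding ν u₀ φ c 0 t = 1) ∧
      (∀ t > 0, rlEmbedding ν u₀ φ c (similarityEta ν α t) t = 0)) := by
  rintro ⟨h0, h1⟩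
  have key : ∀ t : ℝ, 0 < t → wrightW (-2 * α) (-ν) 1 + t ^ (2 * ν - 1) *
      (u₀ / Real.Gamma (2 * ν) - u₀ * wrightW (-2 * α) (-ν) (2 * ν)) = 0 := fun t ht => by
    have hη := (similarityEta_pos (ν := ν) hα ht).le
    have := h1 t ht
    rw [rlEmbedding_eq_of_left_value hν hν' hφ h0 hη ht, auxR_eq_wrightProfile hν hν'.le _ hη ht,
      auxR_eq_wrightProfile hν hν'.le _ hη ht, wrightProfile_similarityEta _ _ ht,
      wrightProfile_similarityEta _ _ ht, sub_self, Real.rpow_zero, fracDelta] at this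
    linear_combination this
  have hpos := (wrightW_neg_mem_Ioo hν hν'.le (x := 2 * α) (by positivity)).1
  rw [← neg_mul] at hpos
  have k1 := key 1 one_pos
  have k2 := key 2 two_pos
  rw [Real.one_rpow, one_mul] at k1
  have hlt : (2 : ℝ) ^ (2 * ν - 1) < 1 :=
    Real.rpow_lt_one_of_one_lt_of_neg one_lt_two (by linarith)
  nlinarith

end

/-! ### The three cases together -/

theorem mainTheorem1 :
    (∀ ν r : ℝ, 0 < ν → ν ≤ 1 / 2 → 0 < r →
      (∃ α : ℝ, 0 < α ∧ TranscendentalEq ν r α) ∧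
      (∀ α u₀ : ℝ, 0 < α →
        wrightW (-2 * α) (-ν) 1 ≠ 1 ∧
        (IsCaputoStefanSolution ν r u₀ (similarityU ν α) (similarityEta ν α) ↔
          (u₀ = -wrightW (-2 * α) (-ν) 1 / (1 - wrightW (-2 * α) (-ν) 1) ∧
            TranscendentalEq ν r α)))) ∧
    (∀ ν u₀ : ℝ, 0 < ν → ν < 1 / 2 →
      ((∀ t > 0, IntervalIntegrable (fun τ => 2 * fracDelta (1 - 2 * ν) τ)
          MeasureTheory.volume 0 t) ∧
        (∀ t > 0, rlEmbedding ν u₀ (fun τ => 2 * fracDelta (1 - 2 * ν) τ) (-2 * u₀) 0 t = 1) ∧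
        (∀ x t : ℝ, 0 ≤ x → 0 < t →
          rlEmbedding ν u₀ (fun τ => 2 * fracDelta (1 - 2 * ν) τ) (-2 * u₀) x t =
            u₀ * fracDelta (2 * ν) t + auxR 1 ν x t - u₀ * auxR (2 * ν) ν x t)) ∧
      (∀ (φ : ℝ → ℝ) (c : ℝ),
        (∀ t > 0, IntervalIntegrable φ MeasureTheory.volume 0 t) →
        ∀ α : ℝ, 0 < α →
          ¬ ((∀ t > 0, rlEmbedding ν u₀ φ c 0 t = 1) ∧
              (∀ t > 0, rlEmbedding ν u₀ φ c (similarityEta ν α t) t = 0)) ∧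
          ∀ r : ℝ, 0 < r →
            ¬ IsRLStefanSolution ν r u₀ (rlEmbedding ν u₀ φ c) (similarityEta ν α))) ∧
    (∀ α : ℝ, 0 < α →
      (∀ x t : ℝ, 0 ≤ x → 0 < t →
        similarityU (1 / 2) α x t = 1 - errorFun (x / (2 * Real.sqrt t)) / errorFun α) ∧
      (∀ t : ℝ, 0 ≤ t → similarityEta (1 / 2) α t = 2 * α * Real.sqrt t) ∧
      (∀ r : ℝ, 0 < r →
        (TranscendentalEq (1 / 2) r α ↔
          r * Real.sqrt Real.pi * α * errorFun α * Real.exp (α ^ 2) = 1))) := by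
  refine ⟨fun ν r hν hν' hr => ⟨exists_transcendentalEq hν hν' hr, fun α u₀ hα =>
    ⟨?_, isCaputoStefanSolution_similarity_iff hν hν' u₀ hr hα⟩⟩, fun ν u₀ hν hν' => ⟨⟨?_, ?_, ?_⟩,
      fun φ c hφ α hα => ⟨rlEmbedding_not_boundary_values hν hν' hφ hα, fun r _ h =>
        rlEmbedding_not_boundary_values hν hν' hφ hα ⟨h.left_value, h.right_value⟩⟩⟩,
    fun α hα => ⟨fun x t hx ht => similarityU_half hα hx ht, fun t _ => ?_,
      fun r _ => transcendentalEq_half_iff⟩⟩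
  · exact (by linarith [one_sub_wrightW_pos hν hν' hα] : wrightW (-2 * α) (-ν) 1 < 1).ne
  · exact fun t _ => (intervalIntegrable_fracDelta (by linarith) t).const_mul 2
  · intro t ht
    rw [rlEmbedding_fracDelta hν hν' u₀ le_rfl ht, auxR_zero_left, auxR_zero_left, fracDelta,
      fracDelta]
    simp
  · exact fun x t hx ht => rlEmbedding_fracDelta hν hν' u₀ hx ht
  · rw [similarityEta, Real.sqrt_eq_rpow]
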